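/- Let $D=D_{[0,\infty)}$ be the space of right continuous functions $[0,\infty)\to\mathbb R$ with finite left limits, let $C\subset D$ be the set of continuous functions, and equip $D$ with the Lindvall–Skorokhod metric $$\rho(x,\varphi)=\sum_{k\ge1}2^{-k}\frac{d_0(x^k,\varphi^k)}{1+d_0(x^k,\varphi^k)},$$ where $x^k_t=x_{\alpha(t)}\,g_k(\alpha(t))$ for $0\le t<1$, $x^k_1=0$, $\alpha(t)=-\log(1-t)$, $g_k(t)=\mathbf 1_{\{t\le k\}}+(k+1-t)\mathbf 1_{\{k<t\le k+1\}}$, and $$d_0(y,z)=\inf_{\mu}\Big\{\sup_{t\le1}|y_t-z_{\mu(t)}|+\sup_{0\le s<t\le1}\Big|\log\frac{\mu(t)-\mu(s)}{t-s}\Big|\Big\},$$ the infimum being over the strictly increasing continuous $\mu:[0,1]\to[0,1]$ with $\mu(0)=0$, $\mu(1)=1$. Let $(\Omega,\mathcal F,P)$ be a probability space and, for each $n\ge1$, let $\mathbb F^n=(\mathcal F^n_t)_{t\ge0}$ be a filtration on it and $X^n=(X^n_t)_{t\ge0}$ an $\mathbb F^n$-adapted process with paths in $D$. For $L>0$ let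 $T_L(\mathbb F^n)$ be the set of $\mathbb F^n$-stopping times $\tau$ with $\tau\le L$. Put $\log 0=-\infty$. **Theorem 3.1.** Assume that for all $L>0$ and $\eta>0$ $$\text{(i)}\quad \lim_{c\to\infty}\varlimsup_{n\to\infty}\frac1n\log P\Big(\sup_{s\le L}|X^n_s|\ge c\Big)=-\infty,$$ $$\text{(ii)}\quad \lim_{\delta\downarrow0}\varlimsup_{n\to\infty}\sup_{\tau\in T_L(\mathbb F^n)}\frac1n\log P\Big(\sup_{t\le\delta}|X^n_{\tau+t}-X^n_\tau|\ge\eta\Big)=-\infty.$$ Then the sequence $(X^n)_{n\ge1}$ is $C$-exponentially tight, that is: (a) it is exponentially tight: for every real $a$ there is a compact $K_a\subset D$ with $\varlimsup_{n}\frac1n\log P(X^n\notin K_a)\le -a$; and (b) if a subsequence $(X^{n'})$ obeys the large deviation principle in $D$ with a rate function $I':D\to[0,\infty]$, then $I'(\varphi)=\infty$ for every $\varphi\in D\setminus C$. Here $(X^{n'})$ obeys the large deviation principle with rate function $I'$ if all the sets $\{\varphi\in D:I'(\varphi)\le a\}$, $0\le a<\infty$, are compact, $\varliminf_{n'}\frac1{n'}\log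 P(X^{n'}\in G)\ge-\inf_{G}I'$ for every open $G\subset D$, and $\varlimsup_{n'}\frac1{n'}\log P(X^{n'}\in F)\le-\inf_{F}I'$ for every closed $F\subset D$. -/

import Mathlib

open Filter Topology MeasureTheory Set
open scoped NNReal ENNReal

noncomputable section

namespace ExpTight

/-- The Skorokhod space `D = D_{[0,∞)}`: real functions on `[0,∞)` that are right continuous and
have (finite) left limits. At `t = 0` the filter `𝓝[<] t` is trivial, so the second condition is
void there. -/
structure SkorokhodSpace where
  toFun : ℝ≥0 → ℝ
  right_continuous : ∀ t, ContinuousWithinAt toFun (Ioi t) t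
  left_limits : ∀ t, ∃ l : ℝ, Tendsto toFun (𝓝[<] t) (𝓝 l)

instance : CoeFun SkorokhodSpace (fun _ => ℝ≥0 → ℝ) := ⟨SkorokhodSpace.toFun⟩

/-- The set `C` of continuous functions, as a subset of `D`. -/
def continuousPaths : Set SkorokhodSpace := {x | Continuous (x : ℝ≥0 → ℝ)}

/-! ### The Lindvall–Skorokhod metric on `D` -/

/-- `g_k(t) = 1` for `t ≤ k`, `k + 1 - t` for `k < t ≤ k + 1`, and `0` for `t > k + 1`. -/
def cutoff (k : ℕ) (t : ℝ≥0) : ℝ :=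
  if t ≤ k then 1 else if t ≤ k + 1 then (k : ℝ) + 1 - t else 0

/-- `α(t) = -log (1 - t)`, used for `0 ≤ t < 1`. -/
def timeScale (t : unitInterval) : ℝ≥0 := Real.toNNReal (-Real.log (1 - (t : ℝ)))

/-- The path `x^k` on `[0,1]`: `x^k_t = x_{α(t)} g_k(α(t))` for `t < 1`, and `x^k_1 = 0`. -/
def localPath (k : ℕ) (x : SkorokhodSpace) (t : unitInterval) : ℝ :=
  if t = 1 then 0 else x (timeScale t) * cutoff k (timeScale t)

/-- `sup_{s < t} |log ((μ(t) - μ(s)) / (t - s))|`, with values in `[0,∞]`, for a time change `μ`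
of `[0,1]`. (Order automorphisms of `[0,1]` are exactly the strictly increasing continuous `μ`
with `μ(0) = 0` and `μ(1) = 1`.) -/
def logSlope (μ : unitInterval ≃o unitInterval) : ℝ≥0∞ :=
  ⨆ (s : unitInterval) (t : unitInterval) (_ : s < t),
    ‖Real.log (((μ t : ℝ) - (μ s : ℝ)) / ((t : ℝ) - (s : ℝ)))‖ₑ

/-- Prokhorov's distance `d₀` between paths on `[0,1]`, with values in `[0,∞]`
(finite for bounded paths). -/
def prokhorovDist (y z : unitInterval → ℝ) : ℝ≥0∞ :=
  ⨅ μ : unitInterval ≃o unitInterval, (⨆ t, ‖y t - z (μ t)‖ₑ) + logSlope μ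

/-- `ρ_k(x, φ) = d₀(x^k, φ^k)`. -/
def localDist (k : ℕ) (x φ : SkorokhodSpace) : ℝ :=
  (prokhorovDist (localPath k x) (localPath k φ)).toReal

/-- The Lindvall–Skorokhod distance `ρ(x, φ) = ∑_{k ≥ 1} 2^{-k} ρ_k(x, φ) / (1 + ρ_k(x, φ))`;
the summation variable is shifted by one. -/
def skorokhodDist (x φ : SkorokhodSpace) : ℝ :=
  ∑' k : ℕ, (1 / 2 : ℝ) ^ (k + 1) * (localDist (k + 1) x φ / (1 + localDist (k + 1) x φ))

/-! Facts that make `ρ` a (pseudo)metric. -/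

lemma SkorokhodSpace.bounded_Iic (x : SkorokhodSpace) (T : ℝ≥0) :
    ∃ M : ℝ, ∀ t ≤ T, |x t| ≤ M := by
  have key : ∃ M : ℝ, ∀ t ∈ Icc 0 T, |x t| ≤ M := by
    refine (isCompact_Icc (a := (0 : ℝ≥0)) (b := T)).induction_on
      (p := fun s => ∃ M : ℝ, ∀ t ∈ s, |x t| ≤ M) ⟨0, by simp⟩ ?_ ?_ ?_
    · rintro s t hst ⟨M, hM⟩
      exact ⟨M, fun u hu => hM u (hst hu)⟩
    · rintro s t ⟨M, hM⟩ ⟨N, hN⟩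
      refine ⟨max M N, ?_⟩
      rintro u (hu | hu)
      · exact (hM u hu).trans (le_max_left _ _)
      · exact (hN u hu).trans (le_max_right _ _)
    · intro t _
      obtain ⟨l, hl⟩ := x.left_limits t
      have h1 : ∀ᶠ u in 𝓝[<] t, |x u| < |l| + 1 :=
        hl.abs.eventually (gt_mem_nhds (by linarith))
      have h2 : ∀ᶠ u in 𝓝[>] t, |x u| < |x t| + 1 :=
        (x.right_continuous t).abs.eventually (gt_mem_nhds (by linarith))
      have h3 : ∀ᶠ u in 𝓝 t, |x u| ≤ |l| + |x t| + 1 := by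
        rw [← nhdsLT_sup_nhdsGE t, ← Ioi_insert, nhdsWithin_insert]
        refine eventually_sup.2 ⟨?_, eventually_sup.2 ⟨?_, ?_⟩⟩
        · filter_upwards [h1] with u hu
          linarith [abs_nonneg (x t)]
        · have : |x t| ≤ |l| + |x t| + 1 := by linarith [abs_nonneg l]
          simpa using this
        · filter_upwards [h2] with u hu
          linarith [abs_nonneg l]
      exact ⟨_, mem_nhdsWithin_of_mem_nhds h3, _, fun u hu => hu⟩
  obtain ⟨M, hM⟩ := key
  exact ⟨M, fun t ht => hM t ⟨zero_le, ht⟩⟩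

lemma abs_cutoff_le (k : ℕ) (t : ℝ≥0) : |cutoff k t| ≤ 1 := by
  unfold cutoff
  split_ifs with h1 h2
  · simp
  · have h1' : (k : ℝ) < t := by exact_mod_cast not_le.1 h1
    have h2' : (t : ℝ) ≤ k + 1 := by exact_mod_cast h2
    rw [abs_le]; constructor <;> linarith
  · simp

lemma localPath_bounded (k : ℕ) (x : SkorokhodSpace) :
    ∃ M : ℝ, ∀ t, |localPath k x t| ≤ M := by
  obtain ⟨M, hM⟩ := x.bounded_Iic (k + 1)
  have hM0 : 0 ≤ M := (abs_nonneg _).trans (hM 0 zero_le)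
  refine ⟨M, fun t => ?_⟩
  unfold localPath
  split_ifs with h
  · simpa using hM0
  · by_cases hk : timeScale t ≤ k + 1
    · rw [abs_mul]
      calc _ ≤ M * 1 := mul_le_mul (hM _ hk) (abs_cutoff_le _ _) (abs_nonneg _) hM0
        _ = M := mul_one M
    · have hk' : ¬ timeScale t ≤ k := fun h' => hk (h'.trans (by simp))
      simp [cutoff, hk, hk', hM0]

lemma logSlope_refl : logSlope (OrderIso.refl _) = 0 := by
  simp only [logSlope, ENNReal.iSup_eq_zero]
  intro s t hst
  have : (t : ℝ) - s ≠ 0 := sub_ne_zero.2 (Subtype.coe_injective.ne hst.ne')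
  simp [div_self this]

lemma logSlope_symm_le (μ : unitInterval ≃o unitInterval) : logSlope μ.symm ≤ logSlope μ := by
  refine iSup_le fun s => iSup_le fun t => iSup_le fun hst => ?_
  have h := le_iSup_of_le (μ.symm s) (le_iSup_of_le (μ.symm t)
    (le_iSup (fun _ : μ.symm s < μ.symm t =>
      ‖Real.log (((μ (μ.symm t) : ℝ) - (μ (μ.symm s) : ℝ)) /
        ((μ.symm t : ℝ) - (μ.symm s : ℝ)))‖ₑ) (μ.symm.lt_iff_lt.2 hst)))
    (f := fun s : unitInterval => ⨆ (t : unitInterval) (_ : s < t),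
      ‖Real.log (((μ t : ℝ) - (μ s : ℝ)) / ((t : ℝ) - (s : ℝ)))‖ₑ)
  refine le_trans (le_of_eq ?_) h
  rw [OrderIso.apply_symm_apply, OrderIso.apply_symm_apply, ← inv_div, Real.log_inv, enorm_neg]

lemma logSlope_trans_le (μ ν : unitInterval ≃o unitInterval) :
    logSlope (μ.trans ν) ≤ logSlope μ + logSlope ν := by
  refine iSup_le fun s => iSup_le fun t => iSup_le fun hst => ?_
  have hμ : μ s < μ t := μ.lt_iff_lt.2 hst
  have hν : ν (μ s) < ν (μ t) := ν.lt_iff_lt.2 hμ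
  have e1 : (t : ℝ) - s ≠ 0 := sub_ne_zero.2 (Subtype.coe_injective.ne hst.ne')
  have e2 : (μ t : ℝ) - μ s ≠ 0 := sub_ne_zero.2 (Subtype.coe_injective.ne hμ.ne')
  have e3 : (ν (μ t) : ℝ) - ν (μ s) ≠ 0 := sub_ne_zero.2 (Subtype.coe_injective.ne hν.ne')
  have h1 : ‖Real.log (((μ t : ℝ) - (μ s : ℝ)) / ((t : ℝ) - (s : ℝ)))‖ₑ ≤ logSlope μ :=
    le_iSup_of_le s (le_iSup_of_le t (le_iSup_of_le hst le_rfl))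
  have h2 : ‖Real.log (((ν (μ t) : ℝ) - (ν (μ s) : ℝ)) / ((μ t : ℝ) - (μ s : ℝ)))‖ₑ
      ≤ logSlope ν :=
    le_iSup_of_le (μ s) (le_iSup_of_le (μ t) (le_iSup_of_le hμ le_rfl))
  refine le_trans ?_ (add_le_add h1 h2)
  refine le_trans (le_of_eq ?_) (enorm_add_le _ _)
  rw [← Real.log_mul (div_ne_zero e2 e1) (div_ne_zero e3 e2)]
  congr 2
  simp only [OrderIso.trans_apply]
  field_simp

lemma prokhorovDist_self (y : unitInterval → ℝ) : prokhorovDist y y = 0 := by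
  refine le_antisymm ((iInf_le _ (OrderIso.refl _)).trans ?_) zero_le
  simp [logSlope_refl]

lemma prokhorovDist_comm_le (y z : unitInterval → ℝ) :
    prokhorovDist y z ≤ prokhorovDist z y := by
  refine le_iInf fun μ => (iInf_le _ μ.symm).trans ?_
  refine add_le_add (iSup_le fun t => ?_) (logSlope_symm_le μ)
  refine le_trans (le_of_eq ?_) (le_iSup (fun t => ‖z t - y (μ t)‖ₑ) (μ.symm t))
  rw [OrderIso.apply_symm_apply, ← enorm_neg, neg_sub]

lemma prokhorovDist_triangle (x y z : unitInterval → ℝ) :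
    prokhorovDist x z ≤ prokhorovDist x y + prokhorovDist y z := by
  unfold prokhorovDist
  refine ENNReal.le_iInf_add_iInf fun μ ν => (iInf_le _ (μ.trans ν)).trans ?_
  rw [add_add_add_comm]
  refine add_le_add (iSup_le fun t => ?_) (logSlope_trans_le μ ν)
  refine le_trans ?_ (add_le_add (le_iSup (fun t => ‖x t - y (μ t)‖ₑ) t)
    (le_iSup (fun t => ‖y t - z (ν t)‖ₑ) (μ t)))
  refine le_trans (le_of_eq ?_) (enorm_add_le _ _)
  simp

lemma prokhorovDist_localPath_ne_top (k : ℕ) (x φ : SkorokhodSpace) :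
    prokhorovDist (localPath k x) (localPath k φ) ≠ ∞ := by
  obtain ⟨M, hM⟩ := localPath_bounded k x
  obtain ⟨N, hN⟩ := localPath_bounded k φ
  refine ne_top_of_le_ne_top (ENNReal.ofReal_ne_top (r := M + N))
    ((iInf_le _ (OrderIso.refl _)).trans ?_)
  rw [logSlope_refl, add_zero]
  refine iSup_le fun t => ?_
  rw [Real.enorm_eq_ofReal_abs]
  exact ENNReal.ofReal_le_ofReal ((abs_sub _ _).trans (add_le_add (hM t) (hN _)))

lemma localDist_nonneg (k : ℕ) (x φ : SkorokhodSpace) : 0 ≤ localDist k x φ :=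
  ENNReal.toReal_nonneg

lemma localDist_comm (k : ℕ) (x φ : SkorokhodSpace) : localDist k x φ = localDist k φ x := by
  unfold localDist
  rw [le_antisymm (prokhorovDist_comm_le (localPath k x) (localPath k φ))
    (prokhorovDist_comm_le _ _)]

lemma localDist_triangle (k : ℕ) (x y z : SkorokhodSpace) :
    localDist k x z ≤ localDist k x y + localDist k y z := by
  unfold localDist
  have h1 := prokhorovDist_localPath_ne_top k x y
  have h2 := prokhorovDist_localPath_ne_top k y z
  rw [← ENNReal.toReal_add h1 h2]
  exact ENNReal.toReal_mono (ENNReal.add_ne_top.2 ⟨h1, h2⟩) (prokhorovDist_triangle _ _ _)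

lemma summable_skorokhodDist (x φ : SkorokhodSpace) :
    Summable fun k : ℕ => (1 / 2 : ℝ) ^ (k + 1) *
      (localDist (k + 1) x φ / (1 + localDist (k + 1) x φ)) := by
  refine Summable.of_nonneg_of_le (fun k => ?_) (fun k => ?_)
    ((summable_nat_add_iff 1).2 (summable_geometric_two))
  · have := localDist_nonneg (k + 1) x φ
    positivity
  · have := localDist_nonneg (k + 1) x φ
    refine mul_le_of_le_one_right (by positivity) ?_
    rw [div_le_one (by positivity)]
    linarith

instance : PseudoMetricSpace SkorokhodSpace where
  dist := skorokhodDist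
  dist_self x := by
    simp [skorokhodDist, localDist, prokhorovDist_self]
  dist_comm x y := by
    simp only [skorokhodDist, localDist_comm _ x y]
  dist_triangle x y z := by
    unfold skorokhodDist
    rw [← (summable_skorokhodDist x y).tsum_add (summable_skorokhodDist y z)]
    refine (summable_skorokhodDist x z).tsum_le_tsum (fun k => ?_)
      ((summable_skorokhodDist x y).add (summable_skorokhodDist y z))
    rw [← mul_add]
    refine mul_le_mul_of_nonneg_left ?_ (by positivity)
    have h := localDist_triangle (k + 1) x y z
    have ha := localDist_nonneg (k + 1) x y
    have hb := localDist_nonneg (k + 1) y z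
    have hc := localDist_nonneg (k + 1) x z
    generalize localDist (k + 1) x y = a at *
    generalize localDist (k + 1) y z = b at *
    generalize localDist (k + 1) x z = c at *
    calc c / (1 + c) ≤ (a + b) / (1 + (a + b)) := by
          rw [div_le_div_iff₀ (by positivity) (by positivity)]; nlinarith
      _ = a / (1 + (a + b)) + b / (1 + (a + b)) := add_div _ _ _
      _ ≤ a / (1 + a) + b / (1 + b) := by
          gcongr <;> linarith

/-! ### Large deviations and exponential tightness -/

variable {Ω : Type*} [MeasurableSpace Ω]

/-- `n⁻¹ log P(A)`, with values in `[-∞,∞]` and `log 0 = -∞` (of interest for `n ≥ 1`). -/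
def logProb (P : Measure Ω) (n : ℕ) (A : Set Ω) : EReal :=
  (((n : ℝ)⁻¹ : ℝ) : EReal) * ENNReal.log (P A)

/-- The sequence `X^n`, `n ≥ 1`, is exponentially tight in `D`. -/
def IsExponentiallyTight (P : Measure Ω) (X : ℕ → Ω → SkorokhodSpace) : Prop :=
  ∀ C : ℝ, ∃ K : Set SkorokhodSpace, IsCompact K ∧
    limsup (fun n : ℕ => logProb P n {ω | X n ω ∉ K}) atTop ≤ ((-C : ℝ) : EReal)

/-- The subsequence `X^{m 0}, X^{m 1}, …` obeys the large deviation principle in `D` with the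
(good) rate function `I`; the normalization of `X^{m j}` is `(m j)⁻¹`. -/
structure ObeysLDP (P : Measure Ω) (X : ℕ → Ω → SkorokhodSpace) (m : ℕ → ℕ)
    (I : SkorokhodSpace → ℝ≥0∞) : Prop where
  isCompact_sublevel : ∀ a : ℝ≥0, IsCompact {φ | I φ ≤ a}
  lower_bound : ∀ G : Set SkorokhodSpace, IsOpen G →
    -((⨅ φ ∈ G, I φ : ℝ≥0∞) : EReal) ≤
      liminf (fun j : ℕ => logProb P (m j) {ω | X (m j) ω ∈ G}) atTop
  upper_bound : ∀ F : Set SkorokhodSpace, IsClosed F →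
    limsup (fun j : ℕ => logProb P (m j) {ω | X (m j) ω ∈ F}) atTop ≤
      -((⨅ φ ∈ F, I φ : ℝ≥0∞) : EReal)

/-- `C`-exponential tightness: exponential tightness, and every rate function of a subsequence
that obeys the large deviation principle is infinite at all discontinuous paths. -/
def IsCExponentiallyTight (P : Measure Ω) (X : ℕ → Ω → SkorokhodSpace) : Prop :=
  IsExponentiallyTight P X ∧
    ∀ (m : ℕ → ℕ) (I : SkorokhodSpace → ℝ≥0∞), StrictMono m → ObeysLDP P X m I →
      ∀ φ ∉ continuousPaths, I φ = ∞

/-- `x^*_L = sup_{s ≤ L} |x_s|`, as an element of `[0,∞]`. -/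
def runningSup (x : SkorokhodSpace) (L : ℝ≥0) : ℝ≥0∞ := ⨆ s ∈ Iic L, ‖x s‖ₑ

/-- `sup_{t ≤ δ} |x_{s + t} - x_s|`, as an element of `[0,∞]`. -/
def oscAfter (x : SkorokhodSpace) (s δ : ℝ≥0) : ℝ≥0∞ := ⨆ t ∈ Iic δ, ‖x (s + t) - x s‖ₑ

/-- `T_L(𝔽)`: the stopping times of the filtration `𝔽` that do not exceed `L`. -/
def boundedStoppingTimes {Ω : Type*} {mΩ : MeasurableSpace Ω} (𝔽 : Filtration ℝ≥0 mΩ) (L : ℝ≥0) :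
    Set (Ω → ℝ≥0) :=
  {τ | IsStoppingTime 𝔽 (fun ω => (τ ω : WithTop ℝ≥0)) ∧ ∀ ω, τ ω ≤ L}

end ExpTight

end

namespace ExpTight

/-! ### Time changes of `[0,1]` -/

/-! Both halves of the theorem rest on `exists_eventually_measure_modulusLE_compl_le`: for each
level `C` some `δ` makes an oscillation above `3η` over a lag at most `δ` in `[0, L]` have
probability at most `exp (-nC)` for large `n`. Constant times `iδ ≤ L` are stopping times, so (ii)
controls each interval `[iδ, (i+1)δ]`; their number does not depend on `n`, hence the union bound is
free on the exponential scale.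

Tightness: paths that are bounded by (i) and have such a modulus are covered by finitely many
`ε`-balls, as in Arzelà–Ascoli (`exists_finite_cover_modulusLE`). This serves all large `n`; each of
the finitely many other `n` gets its own finite cover by separability
(`exists_finite_cover_measure_le`). Intersecting covers with radii tending to `0` gives a totally
bounded set (`isExponentiallyTight_of_finite_cover`), whose closure is compact because `D` is
complete. The metric theory needed is thus completeness, and approximation by step functions, which
yields both separability and the measurability of `ω ↦ dist (X n ω) d` from adaptedness.

Rate function: a jump of `φ` survives, up to a time change and a small error, in every path close to
`φ`. So for every `δ` some ball around `φ` avoids the paths with small `δ`-modulus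
(`exists_ball_disjoint_modulusLE`). Its probability decays at a rate above any prescribed level,
against the LDP lower bound if `I φ` were finite. -/

lemma logSlope_le_iff (μ : unitInterval ≃o unitInterval) {ε : ℝ} (hε : 0 ≤ ε) :
    logSlope μ ≤ ENNReal.ofReal ε ↔ ∀ s t : unitInterval, s < t →
      Real.exp (-ε) * ((t : ℝ) - s) ≤ (μ t : ℝ) - μ s ∧
        (μ t : ℝ) - μ s ≤ Real.exp ε * ((t : ℝ) - s) := by
  simp only [logSlope, iSup_le_iff]
  refine forall_congr' fun s => forall_congr' fun t => forall_congr' fun hst => ?_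
  have h1 : (0 : ℝ) < (t : ℝ) - s := sub_pos.2 hst
  have h2 : (0 : ℝ) < (μ t : ℝ) - μ s := sub_pos.2 (μ.lt_iff_lt.2 hst)
  rw [Real.enorm_eq_ofReal_abs, ENNReal.ofReal_le_ofReal_iff hε, abs_le,
    Real.le_log_iff_exp_le (div_pos h2 h1), Real.log_le_iff_le_exp (div_pos h2 h1),
    le_div_iff₀ h1, div_le_iff₀ h1]

lemma abs_timeChange_sub_le {μ : unitInterval ≃o unitInterval} {ε : ℝ} (hε : 0 ≤ ε)
    (h : logSlope μ ≤ ENNReal.ofReal ε) (t : unitInterval) :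
    |(μ t : ℝ) - t| ≤ Real.exp ε - 1 := by
  have h1 : 1 ≤ Real.exp ε := Real.one_le_exp hε
  rcases eq_or_lt_of_le (unitInterval.nonneg' (t := t)) with h0 | h0
  · have : μ t = 0 := by rw [← h0]; exact μ.map_bot
    rw [this, ← h0]; simpa using hε
  · have hμ0 : μ 0 = 0 := μ.map_bot
    obtain ⟨ha, hb⟩ := (logSlope_le_iff μ hε).1 h 0 t h0
    rw [hμ0] at ha hb
    simp only [Set.Icc.coe_zero, sub_zero] at ha hb
    have ht0 := t.2.1
    have ht1 := t.2.2
    -- This is `cosh ε ≥ 1`; it lets the single bound `exp ε - 1` serve on both sides.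
    have he : 1 - (Real.exp ε - 1) ≤ Real.exp (-ε) := by
      have h3 := Real.add_one_le_exp (-ε)
      have h5 : Real.exp ε * Real.exp (-ε) = 1 := by rw [← Real.exp_add]; simp
      nlinarith [Real.exp_pos (-ε), sq_nonneg (Real.exp ε - 1)]
    rw [abs_le]
    constructor <;> nlinarith

lemma exists_exp_sub_one_lt {b r : ℝ} (hb : 0 < b) (hr : 0 < r) :
    ∃ ε > (0 : ℝ), ε < b ∧ Real.exp ε - 1 < r := by
  have hcont : Tendsto (fun ε : ℝ => Real.exp ε - 1) (𝓝[>] 0) (𝓝 0) := by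
    have : Continuous fun ε : ℝ => Real.exp ε - 1 := by fun_prop
    simpa using (this.tendsto 0).mono_left nhdsWithin_le_nhds
  obtain ⟨ε, ⟨h1, h2⟩, h3⟩ := (((hcont.eventually (gt_mem_nhds hr)).and
    (mem_nhdsWithin_of_mem_nhds (gt_mem_nhds hb))).and self_mem_nhdsWithin).exists
  exact ⟨ε, h3, h2, h1⟩

lemma logSlope_le_of_tendsto {ι : Type*} {l : Filter ι} [l.NeBot]
    {Λ : ι → unitInterval ≃o unitInterval} {μ : unitInterval ≃o unitInterval} {ε : ℝ} (hε : 0 ≤ ε)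
    (hΛ : ∀ t, Tendsto (fun i => Λ i t) l (𝓝 (μ t)))
    (h : ∀ᶠ i in l, logSlope (Λ i) ≤ ENNReal.ofReal ε) : logSlope μ ≤ ENNReal.ofReal ε := by
  rw [logSlope_le_iff μ hε]
  intro s t hst
  have hc : Tendsto (fun i => (Λ i t : ℝ) - Λ i s) l (𝓝 ((μ t : ℝ) - μ s)) :=
    ((continuous_subtype_val.tendsto _).comp (hΛ t)).sub
      ((continuous_subtype_val.tendsto _).comp (hΛ s))
  constructor
  · refine ge_of_tendsto hc ?_
    filter_upwards [h] with i hi using ((logSlope_le_iff _ hε).1 hi s t hst).1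
  · refine le_of_tendsto hc ?_
    filter_upwards [h] with i hi using ((logSlope_le_iff _ hε).1 hi s t hst).2

/-- The lower slope bound gives strict monotonicity, the upper one continuity, and the intermediate
value theorem surjectivity. Since slope bounds survive pointwise limits, this produces limits of
time changes. -/
lemma exists_timeChange {f : unitInterval → ℝ} {ε : ℝ} (hε : 0 ≤ ε) (hf0 : f 0 = 0)
    (hf1 : f 1 = 1)
    (hf : ∀ s t : unitInterval, s < t →
      Real.exp (-ε) * ((t : ℝ) - s) ≤ f t - f s ∧ f t - f s ≤ Real.exp ε * ((t : ℝ) - s)) :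
    ∃ μ : unitInterval ≃o unitInterval, (∀ t, (μ t : ℝ) = f t) ∧
      logSlope μ ≤ ENNReal.ofReal ε := by
  have hmono : StrictMono f := by
    intro s t hst
    have := (hf s t hst).1
    have h2 := mul_pos (Real.exp_pos (-ε)) (sub_pos.2 (show (s : ℝ) < t from hst))
    linarith
  have hc : Continuous f := by
    refine LipschitzWith.continuous (K := (Real.exp ε).toNNReal) (LipschitzWith.of_dist_le_mul ?_)
    have key : ∀ s t : unitInterval, s < t →
        dist (f s) (f t) ≤ (Real.exp ε).toNNReal * dist s t := by
      intro s t hst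
      rw [Real.coe_toNNReal _ (Real.exp_pos ε).le, Subtype.dist_eq, dist_comm (f s),
        dist_comm (s : ℝ), Real.dist_eq, Real.dist_eq, abs_of_pos (sub_pos.2 (hmono hst)),
        abs_of_pos (sub_pos.2 (show (s : ℝ) < t from hst))]
      exact (hf s t hst).2
    intro s t
    rcases lt_trichotomy s t with h | rfl | h
    · exact key s t h
    · simp
    · rw [dist_comm (f s), dist_comm s]
      exact key t s h
  have hmem : ∀ t : unitInterval, f t ∈ Icc (0 : ℝ) 1 := fun t =>
    ⟨hf0 ▸ hmono.monotone t.2.1, hf1 ▸ hmono.monotone t.2.2⟩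
  let g : unitInterval → unitInterval := fun t => ⟨f t, hmem t⟩
  have hg : StrictMono g := fun s t hst => hmono hst
  have hs : Function.Surjective g := by
    intro y
    obtain ⟨t, ht⟩ := mem_range_of_exists_le_of_exists_ge hc
      ⟨0, hf0.le.trans y.2.1⟩ ⟨1, y.2.2.trans hf1.ge⟩
    exact ⟨t, Subtype.ext ht⟩
  refine ⟨hg.orderIsoOfSurjective g hs, fun t => rfl, ?_⟩
  rw [logSlope_le_iff _ hε]
  exact fun s t hst => hf s t hst

/-- An upper bound for `d₀` from a single time change. -/
lemma prokhorovDist_le {y z : unitInterval → ℝ} (μ : unitInterval ≃o unitInterval) {a b : ℝ}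
    (ha : 0 ≤ a) (hb : 0 ≤ b) (h : ∀ t, |y t - z (μ t)| ≤ a)
    (hμ : logSlope μ ≤ ENNReal.ofReal b) : prokhorovDist y z ≤ ENNReal.ofReal (a + b) := by
  rw [ENNReal.ofReal_add ha hb]
  refine (iInf_le _ μ).trans (add_le_add (iSup_le fun t => ?_) hμ)
  rw [Real.enorm_eq_ofReal_abs]
  exact ENNReal.ofReal_le_ofReal (h t)

lemma exists_of_prokhorovDist_lt {y z : unitInterval → ℝ} {ε : ℝ}
    (h : prokhorovDist y z < ENNReal.ofReal ε) :
    ∃ μ : unitInterval ≃o unitInterval, (∀ t, |y t - z (μ t)| ≤ ε) ∧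
      logSlope μ ≤ ENNReal.ofReal ε := by
  obtain ⟨μ, hμ⟩ := iInf_lt_iff.1 h
  have hε : 0 ≤ ε := by
    by_contra hn
    rw [ENNReal.ofReal_of_nonpos (not_le.1 hn).le] at h
    exact not_lt_zero h
  refine ⟨μ, fun t => ?_, le_add_self.trans hμ.le⟩
  have h1 := (le_iSup (fun t => ‖y t - z (μ t)‖ₑ) t).trans (le_self_add.trans hμ.le)
  rw [Real.enorm_eq_ofReal_abs] at h1
  exact (ENNReal.ofReal_le_ofReal_iff hε).1 h1

/-! ### The local distances and the distance of `D` -/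

lemma dist_eq_skorokhodDist (x y : SkorokhodSpace) : dist x y = skorokhodDist x y := rfl

lemma localDist_lt_iff {k : ℕ} {x y : SkorokhodSpace} {ε : ℝ} :
    localDist k x y < ε ↔
      prokhorovDist (localPath k x) (localPath k y) < ENNReal.ofReal ε := by
  unfold localDist
  rw [ENNReal.lt_ofReal_iff_toReal_lt (prokhorovDist_localPath_ne_top k x y)]

lemma localDist_le_of_le {k : ℕ} {x y : SkorokhodSpace} {ε : ℝ} (hε : 0 ≤ ε)
    (h : prokhorovDist (localPath k x) (localPath k y) ≤ ENNReal.ofReal ε) :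
    localDist k x y ≤ ε := ENNReal.toReal_le_of_le_ofReal hε h

lemma localDist_div_le (k : ℕ) (x y : SkorokhodSpace) :
    localDist (k + 1) x y / (1 + localDist (k + 1) x y) ≤ 2 ^ (k + 1) * dist x y := by
  have h := (summable_skorokhodDist x y).le_tsum k (fun j _ => by
    have := localDist_nonneg (j + 1) x y
    positivity)
  have h2 : (2 : ℝ) ^ (k + 1) * (1 / 2 : ℝ) ^ (k + 1) = 1 := by
    rw [← mul_pow]; norm_num
  calc _ = 2 ^ (k + 1) * ((1 / 2 : ℝ) ^ (k + 1) *
        (localDist (k + 1) x y / (1 + localDist (k + 1) x y))) := by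
          rw [← mul_assoc, h2, one_mul]
    _ ≤ _ := by
      rw [dist_eq_skorokhodDist, skorokhodDist]
      gcongr

/-- A single term of the series is at most the whole sum, and `a ↦ a / (1 + a)` is strictly
increasing. -/
lemma exists_localDist_lt (k : ℕ) {ε : ℝ} (hε : 0 < ε) :
    ∃ r > 0, ∀ x y : SkorokhodSpace, dist x y < r → localDist (k + 1) x y < ε := by
  refine ⟨ε / (1 + ε) / 2 ^ (k + 1), by positivity, fun x y h => ?_⟩
  have h1 := localDist_div_le k x y
  have h0 := localDist_nonneg (k + 1) x y
  rw [lt_div_iff₀ (by positivity)] at h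
  have h2 : localDist (k + 1) x y / (1 + localDist (k + 1) x y) < ε / (1 + ε) := by linarith
  rw [div_lt_div_iff₀ (by positivity) (by positivity)] at h2
  nlinarith

lemma tendsto_dist_of_localDist {ι : Type*} {l : Filter ι} {u v : ι → SkorokhodSpace}
    (h : ∀ k, Tendsto (fun i => localDist (k + 1) (u i) (v i)) l (𝓝 0)) :
    Tendsto (fun i => dist (u i) (v i)) l (𝓝 0) := by
  simp only [dist_eq_skorokhodDist, skorokhodDist]
  have key := tendsto_tsum_of_dominated_convergence (𝓕 := l)
    (f := fun i (k : ℕ) => (1 / 2 : ℝ) ^ (k + 1) *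
      (localDist (k + 1) (u i) (v i) / (1 + localDist (k + 1) (u i) (v i))))
    (g := fun _ => 0) (bound := fun k : ℕ => (1 / 2 : ℝ) ^ (k + 1))
    ((summable_nat_add_iff 1).2 summable_geometric_two) (fun k => ?_) (Eventually.of_forall ?_)
  · simpa using key
  · have h1 := ((h k).div ((h k).const_add 1) (by norm_num)).const_mul ((1 / 2 : ℝ) ^ (k + 1))
    simpa using h1
  · intro i k
    have := localDist_nonneg (k + 1) (u i) (v i)
    rw [Real.norm_of_nonneg (by positivity)]
    refine mul_le_of_le_one_right (by positivity) ?_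
    rw [div_le_one (by positivity)]
    linarith

lemma tendsto_of_localDist {ι : Type*} {l : Filter ι} {u : ι → SkorokhodSpace}
    {x : SkorokhodSpace}
    (h : ∀ k, Tendsto (fun i => localDist (k + 1) (u i) x) l (𝓝 0)) : Tendsto u l (𝓝 x) :=
  tendsto_iff_dist_tendsto_zero.2 (tendsto_dist_of_localDist h)

/-! ### Càdlàg functions -/

/-- Right continuous functions with left limits on an ordered space. -/
structure IsCadlag {T : Type*} [TopologicalSpace T] [Preorder T] (y : T → ℝ) : Prop where
  right : ∀ t, ContinuousWithinAt y (Ioi t) t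
  left : ∀ t, ∃ l : ℝ, Tendsto y (𝓝[<] t) (𝓝 l)

section Cadlag

variable {T S : Type*} [TopologicalSpace T] [Preorder T] [TopologicalSpace S] [Preorder S]

lemma tendsto_nhdsGT_of_strictMono {f : T → S} (hf : StrictMono f) (hc : Continuous f) (t : T) :
    Tendsto f (𝓝[>] t) (𝓝[>] (f t)) :=
  hc.continuousWithinAt.tendsto_nhdsWithin fun _ h => hf h

lemma tendsto_nhdsLT_of_strictMono {f : T → S} (hf : StrictMono f) (hc : Continuous f) (t : T) :
    Tendsto f (𝓝[<] t) (𝓝[<] (f t)) :=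
  hc.continuousWithinAt.tendsto_nhdsWithin fun _ h => hf h

lemma IsCadlag.comp {y : S → ℝ} (hy : IsCadlag y) {f : T → S} (hf : StrictMono f)
    (hc : Continuous f) : IsCadlag (fun t => y (f t)) where
  right t := (hy.right (f t)).tendsto.comp (tendsto_nhdsGT_of_strictMono hf hc t)
  left t := by
    obtain ⟨l, hl⟩ := hy.left (f t)
    exact ⟨l, hl.comp (tendsto_nhdsLT_of_strictMono hf hc t)⟩

lemma IsCadlag.of_uniform_approx {y : T → ℝ}
    (h : ∀ ε > 0, ∃ z : T → ℝ, IsCadlag z ∧ ∀ t, |z t - y t| ≤ ε) : IsCadlag y where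
  right t := by
    rw [ContinuousWithinAt, Metric.tendsto_nhds]
    intro ε hε
    obtain ⟨z, hz, hzy⟩ := h (ε / 4) (by positivity)
    filter_upwards [Metric.tendsto_nhds.1 (hz.right t) (ε / 4) (by positivity)] with s hs
    rw [Real.dist_eq] at hs ⊢
    have h1 := abs_le.1 (hzy s)
    have h2 := abs_le.1 (hzy t)
    have h3 := abs_lt.1 hs
    rw [abs_lt]
    constructor <;> linarith
  left t := by
    by_cases hb : (𝓝[<] t).NeBot
    swap
    · rw [not_neBot] at hb
      exact ⟨0, by rw [hb]; exact tendsto_bot⟩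
    refine cauchy_map_iff_exists_tendsto.1 ?_
    rw [Metric.cauchy_iff]
    refine ⟨inferInstance, fun ε hε => ?_⟩
    obtain ⟨z, hz, hzy⟩ := h (ε / 8) (by positivity)
    obtain ⟨l, hl⟩ := hz.left t
    refine ⟨Metric.ball l (ε / 2), ?_, fun a ha b hb => ?_⟩
    · rw [mem_map]
      filter_upwards [Metric.tendsto_nhds.1 hl (ε / 4) (by positivity)] with s hs
      rw [mem_preimage, Metric.mem_ball, Real.dist_eq]
      rw [Real.dist_eq] at hs
      have h1 := abs_le.1 (hzy s)
      have h3 := abs_lt.1 hs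
      rw [abs_lt]
      constructor <;> linarith
    · have := dist_triangle_right a b l
      rw [Metric.mem_ball] at ha hb
      linarith

end Cadlag

/-! ### The time scale and the cutoff weights -/

/-- The inverse `t ↦ 1 - exp (-t)` of the time scale. -/
noncomputable def timeScaleInv (t : ℝ≥0) : unitInterval :=
  ⟨1 - Real.exp (-t), by
    have h1 := Real.exp_pos (-(t : ℝ))
    have h2 : Real.exp (-(t : ℝ)) ≤ 1 := Real.exp_le_one_iff.2 (by simp)
    constructor <;> linarith⟩

lemma coe_timeScaleInv (t : ℝ≥0) : (timeScaleInv t : ℝ) = 1 - Real.exp (-t) := rfl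

lemma timeScaleInv_lt_one (t : ℝ≥0) : timeScaleInv t < 1 := by
  have := Real.exp_pos (-(t : ℝ))
  exact Subtype.coe_lt_coe.1 (by rw [coe_timeScaleInv, Set.Icc.coe_one]; linarith)

lemma continuous_timeScaleInv : Continuous timeScaleInv := by
  unfold timeScaleInv
  fun_prop

lemma strictMono_timeScaleInv : StrictMono timeScaleInv := by
  intro s t hst
  refine Subtype.coe_lt_coe.1 ?_
  rw [coe_timeScaleInv, coe_timeScaleInv]
  have : Real.exp (-(t : ℝ)) < Real.exp (-(s : ℝ)) :=
    Real.exp_lt_exp.2 (neg_lt_neg (NNReal.coe_lt_coe.2 hst))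
  linarith

lemma timeScale_timeScaleInv (t : ℝ≥0) : timeScale (timeScaleInv t) = t := by
  simp [timeScale, coe_timeScaleInv]

lemma timeScaleInv_timeScale {u : unitInterval} (hu : u ≠ 1) :
    timeScaleInv (timeScale u) = u := by
  have h1 : (u : ℝ) < 1 := unitInterval.lt_one_iff_ne_one.2 hu
  have h0 : 0 ≤ (u : ℝ) := u.2.1
  refine Subtype.ext ?_
  rw [coe_timeScaleInv, timeScale, Real.coe_toNNReal, neg_neg, Real.exp_log (by linarith)]
  · ring
  · have := Real.log_nonpos (x := 1 - (u : ℝ)) (by linarith) (by linarith)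
    linarith

lemma timeScale_lt_iff {u : unitInterval} (hu : u ≠ 1) {t : ℝ≥0} :
    timeScale u < t ↔ u < timeScaleInv t := by
  conv_rhs => rw [← timeScaleInv_timeScale hu]
  exact strictMono_timeScaleInv.lt_iff_lt.symm

lemma timeScale_le_iff {u : unitInterval} (hu : u ≠ 1) {t : ℝ≥0} :
    timeScale u ≤ t ↔ u ≤ timeScaleInv t := by
  conv_rhs => rw [← timeScaleInv_timeScale hu]
  exact strictMono_timeScaleInv.le_iff_le.symm

lemma continuousAt_timeScale {u : unitInterval} (hu : u ≠ 1) : ContinuousAt timeScale u := by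
  have h1 : (u : ℝ) < 1 := unitInterval.lt_one_iff_ne_one.2 hu
  unfold timeScale
  refine continuous_real_toNNReal.continuousAt.comp ?_
  have h : ContinuousAt (fun t : unitInterval => 1 - (t : ℝ)) u := by fun_prop
  exact (h.log (by linarith : (1 : ℝ) - u ≠ 0)).neg

/-- The cutoff `g_k(α(u))`, extended by `0` to `u = 1`. -/
noncomputable def cutoffWeight (k : ℕ) (u : unitInterval) : ℝ := if u = 1 then 0 else cutoff k (timeScale u)

lemma localPath_eq_mul (k : ℕ) (x : SkorokhodSpace) (u : unitInterval) :
    localPath k x u = x (timeScale u) * cutoffWeight k u := by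
  unfold localPath cutoffWeight
  split_ifs <;> simp

lemma abs_cutoffWeight_le (k : ℕ) (u : unitInterval) : |cutoffWeight k u| ≤ 1 := by
  unfold cutoffWeight
  split_ifs
  · simp
  · exact abs_cutoff_le _ _

lemma cutoff_eq_max_min (k : ℕ) (t : ℝ≥0) : cutoff k t = max 0 (min 1 ((k : ℝ) + 1 - t)) := by
  unfold cutoff
  split_ifs with h1 h2
  · have : (t : ℝ) ≤ k := by exact_mod_cast h1
    rw [min_eq_left (by linarith), max_eq_right zero_le_one]
  · have h1' : (k : ℝ) < t := by exact_mod_cast not_le.1 h1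
    have h2' : (t : ℝ) ≤ k + 1 := by exact_mod_cast h2
    rw [min_eq_right (by linarith), max_eq_right (by linarith)]
  · have h2' : (k : ℝ) + 1 < t := by exact_mod_cast not_le.1 h2
    rw [min_eq_right (by linarith), max_eq_left (by linarith)]

lemma continuous_cutoff (k : ℕ) : Continuous (cutoff k) := by
  rw [show cutoff k = fun t : ℝ≥0 => max 0 (min 1 ((k : ℝ) + 1 - t)) from
    funext (cutoff_eq_max_min k)]
  fun_prop

lemma cutoffWeight_eq_one {k : ℕ} {u : unitInterval} (h : u ≤ timeScaleInv k) :
    cutoffWeight k u = 1 := by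
  have hu : u ≠ 1 := (h.trans_lt (timeScaleInv_lt_one _)).ne
  rw [cutoffWeight, if_neg hu, cutoff, if_pos ((timeScale_le_iff hu).2 h)]

lemma cutoffWeight_eq_zero {k : ℕ} {u : unitInterval} (h : timeScaleInv (k + 1) < u) :
    cutoffWeight k u = 0 := by
  unfold cutoffWeight
  split_ifs with hu
  · rfl
  · have h2 : ¬ timeScale u ≤ k + 1 := fun h' => absurd ((timeScale_le_iff hu).1 h') (not_le.2 h)
    have h1 : ¬ timeScale u ≤ k := fun h' => h2 (h'.trans (by simp))
    rw [cutoff, if_neg h1, if_neg h2]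

/-- The weight of index `k + 1` equals `1` wherever that of index `k` is nonzero. Hence multiplying
`x^{k+1}` by the weight of index `k` recovers `x^k`, the compatibility that glues local limits. -/
lemma cutoffWeight_mul_succ (k : ℕ) (u : unitInterval) :
    cutoffWeight (k + 1) u * cutoffWeight k u = cutoffWeight k u := by
  rcases le_or_gt u (timeScaleInv (k + 1)) with h | h
  · rw [cutoffWeight_eq_one (by exact_mod_cast h), one_mul]
  · rw [cutoffWeight_eq_zero h, mul_zero]

lemma continuous_cutoffWeight (k : ℕ) : Continuous (cutoffWeight k) := by
  refine continuous_iff_continuousAt.2 fun u => ?_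
  by_cases hu : u = 1
  · subst hu
    have : cutoffWeight k =ᶠ[𝓝 1] fun _ => 0 := by
      filter_upwards [lt_mem_nhds (timeScaleInv_lt_one (k + 1))] with v hv
      exact cutoffWeight_eq_zero hv
    exact this.continuousAt
  · have : cutoffWeight k =ᶠ[𝓝 u] fun v => cutoff k (timeScale v) := by
      filter_upwards [isOpen_ne.mem_nhds hu] with v hv
      rw [cutoffWeight, if_neg hv]
    exact ((continuous_cutoff k).continuousAt.comp (continuousAt_timeScale hu)).congr this.symm

lemma isCadlag_localPath (k : ℕ) (x : SkorokhodSpace) : IsCadlag (localPath k x) := by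
  have hw : ∀ u, Tendsto (cutoffWeight k) (𝓝 u) (𝓝 (cutoffWeight k u)) := fun u =>
    (continuous_cutoffWeight k).tendsto u
  have hfun : localPath k x = fun u => x (timeScale u) * cutoffWeight k u :=
    funext (localPath_eq_mul k x)
  rw [hfun]
  constructor
  · intro u
    by_cases hu : u = 1
    · subst hu
      have : Ioi (1 : unitInterval) = ∅ := Set.Ioi_eq_empty_iff.2 (fun v _ => unitInterval.le_one')
      rw [this, ContinuousWithinAt, nhdsWithin_empty]
      exact tendsto_bot
    · refine Tendsto.mul ?_ ((hw u).mono_left nhdsWithin_le_nhds)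
      refine (x.right_continuous (timeScale u)).tendsto.comp ?_
      refine tendsto_nhdsWithin_iff.2
        ⟨(continuousAt_timeScale hu).tendsto.mono_left nhdsWithin_le_nhds, ?_⟩
      filter_upwards [self_mem_nhdsWithin, mem_nhdsWithin_of_mem_nhds (isOpen_ne.mem_nhds hu)]
        with v hv hv1
      rw [mem_Ioi, ← not_le, timeScale_le_iff hv1, timeScaleInv_timeScale hu]
      exact not_le.2 hv
  · intro u
    by_cases hu : u = 1
    · subst hu
      refine ⟨0, tendsto_const_nhds.congr' ?_⟩
      filter_upwards [mem_nhdsWithin_of_mem_nhds (lt_mem_nhds (timeScaleInv_lt_one (k + 1)))]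
        with v hv
      rw [cutoffWeight_eq_zero hv, mul_zero]
    · obtain ⟨l, hl⟩ := x.left_limits (timeScale u)
      refine ⟨l * cutoffWeight k u, Tendsto.mul ?_ ((hw u).mono_left nhdsWithin_le_nhds)⟩
      refine hl.comp ?_
      refine tendsto_nhdsWithin_iff.2
        ⟨(continuousAt_timeScale hu).tendsto.mono_left nhdsWithin_le_nhds, ?_⟩
      filter_upwards [self_mem_nhdsWithin, mem_nhdsWithin_of_mem_nhds (isOpen_ne.mem_nhds hu)]
        with v hv hv1
      rw [mem_Iio, timeScale_lt_iff hv1, timeScaleInv_timeScale hu]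
      exact hv

/-! ### Completeness -/

lemma logSlope_symm_trans_le {μ Λ : ℕ → unitInterval ≃o unitInterval}
    (hμ : ∀ n, logSlope (μ n) ≤ ENNReal.ofReal ((1 / 2) ^ n))
    (hΛ : ∀ n, Λ (n + 1) = (Λ n).trans (μ n)) {n m : ℕ} (hnm : n ≤ m) :
    logSlope ((Λ n).symm.trans (Λ m)) ≤ ENNReal.ofReal (2 * (1 / 2) ^ n) := by
  -- The sharp partial sum of the geometric series is what the induction on `m` can carry.
  suffices h : logSlope ((Λ n).symm.trans (Λ m)) ≤
      ENNReal.ofReal (2 * (1 / 2) ^ n - 2 * (1 / 2) ^ m) by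
    refine h.trans (ENNReal.ofReal_le_ofReal ?_)
    have : (0 : ℝ) < (1 / 2) ^ m := by positivity
    linarith
  induction m, hnm using Nat.le_induction with
  | base =>
    have : (Λ n).symm.trans (Λ n) = OrderIso.refl _ := by ext; simp
    rw [this, logSlope_refl]
    exact zero_le
  | succ m hnm ih =>
    have : (Λ n).symm.trans (Λ (m + 1)) = ((Λ n).symm.trans (Λ m)).trans (μ m) := by
      rw [hΛ]; rfl
    rw [this]
    refine (logSlope_trans_le _ _).trans ((add_le_add ih (hμ m)).trans ?_)
    rw [← ENNReal.ofReal_add _ (by positivity)]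
    · refine ENNReal.ofReal_le_ofReal (le_of_eq ?_)
      rw [pow_succ]; ring
    · have : (1 / 2 : ℝ) ^ m ≤ (1 / 2) ^ n :=
        pow_le_pow_of_le_one (by norm_num) (by norm_num) hnm
      linarith

/-- Along the composed time changes `Λ n` the paths `x n ∘ Λ n` converge uniformly, to a càdlàg `h`.
The log slopes are summable, so the `Λ n` converge to a genuine time change `ν` instead of
degenerating; the limit is `h ∘ ν⁻¹`. -/
lemma exists_prokhorovDist_limit_of_summable {x : ℕ → unitInterval → ℝ}
    (hx : ∀ n, IsCadlag (x n))
    (hd : ∀ n, prokhorovDist (x n) (x (n + 1)) < ENNReal.ofReal ((1 / 2) ^ n)) :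
    ∃ y, IsCadlag y ∧ ∀ n, prokhorovDist (x n) y ≤ ENNReal.ofReal (4 * (1 / 2) ^ n) := by
  choose μ hμx hμ using fun n => exists_of_prokhorovDist_lt (hd n)
  let Λ : ℕ → unitInterval ≃o unitInterval :=
    fun n => Nat.rec (OrderIso.refl _) (fun n Λn => Λn.trans (μ n)) n
  have hΛ : ∀ n, Λ (n + 1) = (Λ n).trans (μ n) := fun n => rfl
  have hΛ0 : Λ 0 = OrderIso.refl _ := rfl
  -- The factor `2` comes from `|exp x - 1| ≤ 2 |x|` for `|x| ≤ 1`.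
  have hstep : ∀ n t, dist (Λ n t) (Λ (n + 1) t) ≤ 2 * (1 / 2 : ℝ) ^ n := by
    intro n t
    have hp : (0 : ℝ) ≤ (1 / 2) ^ n := by positivity
    have hp1 : (1 / 2 : ℝ) ^ n ≤ 1 := pow_le_one₀ (by norm_num) (by norm_num)
    rw [dist_comm, Subtype.dist_eq, Real.dist_eq, hΛ]
    refine (abs_timeChange_sub_le hp (hμ n) (Λ n t)).trans ?_
    have := Real.abs_exp_sub_one_le (x := (1 / 2 : ℝ) ^ n) (by rwa [abs_of_nonneg hp])
    rw [abs_of_nonneg hp] at this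
    exact (le_abs_self _).trans this
  choose L hL using fun t => cauchySeq_tendsto_of_complete
    (cauchySeq_of_le_geometric (1 / 2) 2 (by norm_num) (fun n => hstep n t))
  have hslope : ∀ n, logSlope (Λ n) ≤ ENNReal.ofReal 2 := by
    intro n
    have h := logSlope_symm_trans_le hμ hΛ (Nat.zero_le n)
    have h2 : (Λ 0).symm.trans (Λ n) = Λ n := by rw [hΛ0]; rfl
    simpa [h2] using h
  obtain ⟨ν, hν, -⟩ := exists_timeChange (f := fun t => (L t : ℝ)) (ε := 2) (by norm_num)
    (by
      have h0 : Tendsto (fun n => Λ n 0) atTop (𝓝 0) := by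
        simpa only [show ∀ n, Λ n 0 = 0 from fun n => (Λ n).map_bot] using tendsto_const_nhds
      rw [tendsto_nhds_unique (hL 0) h0]; simp)
    (by
      have h1 : Tendsto (fun n => Λ n 1) atTop (𝓝 1) := by
        simpa only [show ∀ n, Λ n 1 = 1 from fun n => (Λ n).map_top] using tendsto_const_nhds
      rw [tendsto_nhds_unique (hL 1) h1]; simp)
    (by
      intro s t hst
      have hc : Tendsto (fun i => (Λ i t : ℝ) - Λ i s) atTop (𝓝 ((L t : ℝ) - L s)) :=
        ((continuous_subtype_val.tendsto _).comp (hL t)).sub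
          ((continuous_subtype_val.tendsto _).comp (hL s))
      have hb := fun n => (logSlope_le_iff (Λ n) (by norm_num)).1 (hslope n) s t hst
      exact ⟨ge_of_tendsto' hc fun n => (hb n).1, le_of_tendsto' hc fun n => (hb n).2⟩)
  have hΛν : ∀ t, Tendsto (fun n => Λ n t) atTop (𝓝 (ν t)) := by
    intro t
    rw [show ν t = L t from Subtype.ext (hν t)]
    exact hL t
  have hxstep : ∀ t n, dist (x n (Λ n t)) (x (n + 1) (Λ (n + 1) t)) ≤ 1 * (1 / 2 : ℝ) ^ n := by
    intro t n
    rw [Real.dist_eq, one_mul, hΛ]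
    exact hμx n (Λ n t)
  choose h hh using fun t => cauchySeq_tendsto_of_complete
    (cauchySeq_of_le_geometric (1 / 2) 1 (by norm_num) (hxstep t))
  have hxh : ∀ n t, |x n (Λ n t) - h t| ≤ 2 * (1 / 2 : ℝ) ^ n := by
    intro n t
    have := dist_le_of_le_geometric_of_tendsto (1 / 2) 1 (by norm_num) (hxstep t) (hh t) n
    rw [Real.dist_eq] at this
    refine this.trans (le_of_eq ?_)
    ring
  have hcad : IsCadlag h := by
    refine IsCadlag.of_uniform_approx fun ε hε => ?_
    obtain ⟨n, hn⟩ := exists_pow_lt_of_lt_one (show 0 < ε / 2 by positivity)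
      (show (1 / 2 : ℝ) < 1 by norm_num)
    exact ⟨fun t => x n (Λ n t), (hx n).comp (Λ n).strictMono (Λ n).continuous,
      fun t => (hxh n t).trans (by linarith)⟩
  refine ⟨fun t => h (ν.symm t), hcad.comp ν.symm.strictMono ν.symm.continuous, fun n => ?_⟩
  have hp : (0 : ℝ) ≤ 2 * (1 / 2) ^ n := by positivity
  refine (prokhorovDist_le ((Λ n).symm.trans ν) hp hp (fun t => ?_) ?_).trans
    (ENNReal.ofReal_le_ofReal (by linarith))
  · have := hxh n ((Λ n).symm t)
    rw [OrderIso.apply_symm_apply] at this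
    simpa using this
  · refine logSlope_le_of_tendsto (l := atTop) (Λ := fun m => (Λ n).symm.trans (Λ m)) hp
      (fun t => hΛν _) ?_
    filter_upwards [eventually_ge_atTop n] with m hm using logSlope_symm_trans_le hμ hΛ hm

lemma exists_prokhorovDist_limit {x : ℕ → unitInterval → ℝ} (hx : ∀ n, IsCadlag (x n))
    (hc : ∀ ε > (0 : ℝ), ∃ N, ∀ m ≥ N, ∀ n ≥ N, prokhorovDist (x m) (x n) < ENNReal.ofReal ε) :
    ∃ y, IsCadlag y ∧
      ∀ ε > (0 : ℝ), ∀ᶠ n in atTop, prokhorovDist (x n) y < ENNReal.ofReal ε := by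
  choose N hN using fun j : ℕ => hc ((1 / 2) ^ j) (by positivity)
  -- Partial sums are a cheap choice of indices that are monotone and dominate `N`.
  let φ : ℕ → ℕ := fun j => ∑ i ∈ Finset.range (j + 1), N i
  have hφN : ∀ j, N j ≤ φ j := fun j =>
    Finset.single_le_sum (f := N) (fun _ _ => Nat.zero_le _) (Finset.self_mem_range_succ j)
  have hφs : ∀ j, φ j ≤ φ (j + 1) := fun j => by
    simp only [φ]
    rw [Finset.sum_range_succ _ (j + 1)]
    exact Nat.le_add_right _ _
  obtain ⟨y, hy, hd⟩ := exists_prokhorovDist_limit_of_summable (x := fun j => x (φ j))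
    (fun j => hx _) (fun j => hN j _ (hφN j) _ ((hφN j).trans (hφs j)))
  refine ⟨y, hy, fun ε hε => ?_⟩
  obtain ⟨j, hj⟩ := exists_pow_lt_of_lt_one (show 0 < ε / 5 by positivity)
    (show (1 / 2 : ℝ) < 1 by norm_num)
  filter_upwards [eventually_ge_atTop (N j)] with n hn
  refine (prokhorovDist_triangle _ (x (φ j)) _).trans_lt ?_
  refine (ENNReal.add_lt_add_of_lt_of_le ?_ (hN j n hn _ (hφN j)) (hd j)).trans_le ?_
  · exact ne_top_of_le_ne_top ENNReal.ofReal_ne_top (hd j)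
  · rw [← ENNReal.ofReal_add (by positivity) (by positivity)]
    exact ENNReal.ofReal_le_ofReal (by linarith)

/-- Just to the right of `t < 1` both functions are close to their values at `t`. A time change near
the identity keeps a point `s` of that interval inside it, so `y t ≈ y s ≈ z (μ s) ≈ z t`. The
endpoint `1` is fixed by every time change. -/
lemma IsCadlag.eq_of_prokhorovDist_eq_zero {y z : unitInterval → ℝ} (hy : IsCadlag y)
    (hz : IsCadlag z) (h : prokhorovDist y z = 0) : y = z := by
  have hex : ∀ ε > (0 : ℝ), ∃ μ : unitInterval ≃o unitInterval, (∀ t, |y t - z (μ t)| ≤ ε) ∧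
      logSlope μ ≤ ENNReal.ofReal ε := fun ε hε =>
    exists_of_prokhorovDist_lt (by rw [h]; exact ENNReal.ofReal_pos.2 hε)
  funext t
  refine eq_of_abs_sub_le_all fun ε hε => ?_
  rcases eq_or_lt_of_le (unitInterval.le_one' (t := t)) with rfl | ht
  · obtain ⟨μ, hμ, -⟩ := hex ε hε
    have := hμ 1
    rwa [show μ 1 = 1 from μ.map_top] at this
  · have hye := Metric.tendsto_nhds.1 (hy.right t) (ε / 3) (by positivity)
    have hze := Metric.tendsto_nhds.1 (hz.right t) (ε / 3) (by positivity)
    obtain ⟨b, hb, hbs⟩ := (mem_nhdsGT_iff_exists_Ioo_subset' ht).1 (hye.and hze)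
    obtain ⟨s, hts, hsb⟩ := exists_between (mem_Ioi.1 hb)
    have hgap : 0 < min ((s : ℝ) - t) (b - s) := lt_min (sub_pos.2 hts) (sub_pos.2 hsb)
    obtain ⟨η, hη, -, hηe⟩ := exists_exp_sub_one_lt one_pos hgap
    obtain ⟨μ, hμ, hμs⟩ := hex (min η (ε / 3)) (lt_min hη (by positivity))
    have hμs' := abs_timeChange_sub_le hη.le
      (hμs.trans (ENNReal.ofReal_le_ofReal (min_le_left _ _))) s
    have h1 := abs_le.1 hμs'
    have h2 := min_le_left ((s : ℝ) - t) (b - s)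
    have h3 := min_le_right ((s : ℝ) - t) (b - s)
    have hm1 : t < μ s := Subtype.coe_lt_coe.1 (by linarith)
    have hm2 : μ s < b := Subtype.coe_lt_coe.1 (by linarith)
    have e1 := abs_lt.1 (hbs ⟨hts, hsb⟩).1
    have e2 := abs_lt.1 (hbs ⟨hm1, hm2⟩).2
    have e3 := abs_le.1 ((hμ s).trans (min_le_right _ _))
    rw [abs_le]
    constructor <;> linarith

lemma prokhorovDist_mul_lt {w z : unitInterval → ℝ} (hw : Continuous w) (hw1 : ∀ t, |w t| ≤ 1)
    {M : ℝ} (hM : ∀ t, |z t| ≤ M) {ε : ℝ} (hε : 0 < ε) :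
    ∃ δ > (0 : ℝ), ∀ y, prokhorovDist y z < ENNReal.ofReal δ →
      prokhorovDist (fun t => y t * w t) (fun t => z t * w t) < ENNReal.ofReal ε := by
  have hM0 : 0 ≤ M := (abs_nonneg _).trans (hM 0)
  obtain ⟨r, hr, hrw⟩ := Metric.uniformContinuous_iff.1
    (CompactSpace.uniformContinuous_of_continuous hw) (ε / (4 * (M + 1))) (by positivity)
  obtain ⟨η, hη, -, hηe⟩ := exists_exp_sub_one_lt one_pos hr
  refine ⟨min η (ε / 4), lt_min hη (by positivity), fun y hyz => ?_⟩
  obtain ⟨μ, hμ, hμs⟩ := exists_of_prokhorovDist_lt hyz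
  refine (prokhorovDist_le μ (a := ε / 2) (b := ε / 4) (by positivity) (by positivity)
    (fun t => ?_) (hμs.trans (ENNReal.ofReal_le_ofReal (min_le_right _ _)))).trans_lt
    ((ENNReal.ofReal_lt_ofReal_iff hε).2 (by linarith))
  have hd : dist (w t) (w (μ t)) < ε / (4 * (M + 1)) := by
    refine hrw ?_
    rw [dist_comm, Subtype.dist_eq, Real.dist_eq]
    exact (abs_timeChange_sub_le hη.le
      (hμs.trans (ENNReal.ofReal_le_ofReal (min_le_left _ _))) t).trans_lt hηe
  rw [Real.dist_eq] at hd
  have e : y t * w t - z (μ t) * w (μ t) =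
      (y t - z (μ t)) * w t + z (μ t) * (w t - w (μ t)) := by ring
  rw [e]
  refine (abs_add_le _ _).trans ?_
  rw [abs_mul, abs_mul]
  have h1 : |y t - z (μ t)| * |w t| ≤ ε / 4 * 1 :=
    mul_le_mul ((hμ t).trans (min_le_right _ _)) (hw1 t) (abs_nonneg _) (by positivity)
  have h2 : |z (μ t)| * |w t - w (μ t)| ≤ M * (ε / (4 * (M + 1))) :=
    mul_le_mul (hM _) hd.le (abs_nonneg _) hM0
  have h3 : M * (ε / (4 * (M + 1))) ≤ ε / 4 := by
    rw [mul_div_assoc', div_le_div_iff₀ (by positivity) (by positivity)]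
    nlinarith
  linarith

/-- Local limits `y k` that fit together come from one element of `D`. -/
lemma exists_localPath_eq {y : ℕ → unitInterval → ℝ} (hy : ∀ k, IsCadlag (y k))
    (hcomp : ∀ k t, y k t = y (k + 1) t * cutoffWeight (k + 1) t) :
    ∃ x : SkorokhodSpace, ∀ k, localPath (k + 1) x = y k := by
  -- Indices are shifted: `y k` plays the role of `x^{k+1}`, so it is uncut up to time `k + 1`.
  have hstep : ∀ (k : ℕ) (t : ℝ≥0), t ≤ k + 1 → y k (timeScaleInv t) = y (k + 1) (timeScaleInv t) := by
    intro k t ht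
    rw [hcomp k, cutoffWeight_eq_one, mul_one]
    exact strictMono_timeScaleInv.monotone (by exact_mod_cast ht)
  have hle : ∀ (k m : ℕ) (t : ℝ≥0), k ≤ m → t ≤ k + 1 →
      y k (timeScaleInv t) = y m (timeScaleInv t) := by
    intro k m t hkm ht
    induction m, hkm using Nat.le_induction with
    | base => rfl
    | succ m hkm ih =>
      rw [ih, hstep]
      exact ht.trans (by exact_mod_cast Nat.succ_le_succ hkm)
  let f : ℝ≥0 → ℝ := fun t => y ⌈t⌉₊ (timeScaleInv t)
  have hf : ∀ (k : ℕ) (t : ℝ≥0), t ≤ k → f t = y k (timeScaleInv t) := by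
    intro k t ht
    exact hle _ _ _ (Nat.ceil_le.2 ht) ((Nat.le_ceil t).trans (by simp))
  have hloc : ∀ t : ℝ≥0, ∃ k : ℕ, f =ᶠ[𝓝 t] fun s => y k (timeScaleInv s) := by
    intro t
    obtain ⟨k, hk⟩ := exists_nat_gt t
    refine ⟨k, ?_⟩
    filter_upwards [gt_mem_nhds hk] with s hs using hf k s hs.le
  have hcad : ∀ k, IsCadlag fun s => y k (timeScaleInv s) := fun k =>
    (hy k).comp strictMono_timeScaleInv continuous_timeScaleInv
  let x : SkorokhodSpace :=
    { toFun := f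
      right_continuous := fun t => by
        obtain ⟨k, hk⟩ := hloc t
        exact ((hcad k).right t).congr_of_eventuallyEq (hk.filter_mono nhdsWithin_le_nhds)
          hk.self_of_nhds
      left_limits := fun t => by
        obtain ⟨k, hk⟩ := hloc t
        obtain ⟨l, hl⟩ := (hcad k).left t
        exact ⟨l, hl.congr' (hk.symm.filter_mono nhdsWithin_le_nhds)⟩ }
  refine ⟨x, fun k => funext fun u => ?_⟩
  rw [localPath_eq_mul, hcomp]
  by_cases hu : u = 1
  · simp [cutoffWeight, hu]
  rcases le_or_gt u (timeScaleInv ((k + 1 : ℕ) + 1)) with h | h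
  · congr 1
    change f (timeScale u) = _
    have h1 := (timeScale_le_iff hu).2 h
    rw [hf (k + 1 + 1) _ (by exact_mod_cast h1), ← hstep (k + 1) _ (by exact_mod_cast h1),
      timeScaleInv_timeScale hu]
  · rw [cutoffWeight_eq_zero h, mul_zero, mul_zero]

/-- Each local path sequence has a càdlàg limit. These limits are compatible because multiplication
by a continuous weight is continuous for `d₀` at a bounded path and `d₀` separates càdlàg functions.
-/
instance : CompleteSpace SkorokhodSpace := by
  refine Metric.complete_of_cauchySeq_tendsto fun u hu => ?_
  have hcauchy : ∀ k, ∀ ε > (0 : ℝ), ∃ N, ∀ m ≥ N, ∀ n ≥ N,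
      prokhorovDist (localPath (k + 1) (u m)) (localPath (k + 1) (u n)) < ENNReal.ofReal ε := by
    intro k ε hε
    obtain ⟨r, hr, h⟩ := exists_localDist_lt k hε
    obtain ⟨N, hN⟩ := Metric.cauchySeq_iff.1 hu r hr
    exact ⟨N, fun m hm n hn => localDist_lt_iff.1 (h _ _ (hN m hm n hn))⟩
  choose y hy hlim using fun k => exists_prokhorovDist_limit
    (fun n => isCadlag_localPath (k + 1) (u n)) (hcauchy k)
  have hbdd : ∀ k, ∃ M, ∀ t, |y k t| ≤ M := by
    intro k
    obtain ⟨n, hn⟩ := (hlim k 1 one_pos).exists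
    obtain ⟨μ, hμ, -⟩ := exists_of_prokhorovDist_lt hn
    obtain ⟨M, hM⟩ := localPath_bounded (k + 1) (u n)
    refine ⟨M + 1, fun t => ?_⟩
    have h1 := hμ (μ.symm t)
    rw [OrderIso.apply_symm_apply] at h1
    have h2 := abs_le.1 h1
    have h3 := abs_le.1 (hM (μ.symm t))
    rw [abs_le]
    constructor <;> linarith
  have hcomp : ∀ k t, y k t = y (k + 1) t * cutoffWeight (k + 1) t := by
    intro k
    have hprod : IsCadlag fun t => y (k + 1) t * cutoffWeight (k + 1) t := by
      have hw := continuous_cutoffWeight (k + 1)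
      refine ⟨fun t => ((hy (k + 1)).right t).mul hw.continuousWithinAt, fun t => ?_⟩
      obtain ⟨l, hl⟩ := (hy (k + 1)).left t
      exact ⟨_, hl.mul ((hw.tendsto t).mono_left nhdsWithin_le_nhds)⟩
    refine congrFun ((hy k).eq_of_prokhorovDist_eq_zero hprod ?_)
    refine le_antisymm (ENNReal.le_of_forall_pos_le_add fun ε hε _ => ?_) zero_le
    have hε' : (0 : ℝ) < ε / 2 := by positivity
    obtain ⟨M, hM⟩ := hbdd (k + 1)
    obtain ⟨δ, hδ, hmul⟩ := prokhorovDist_mul_lt (continuous_cutoffWeight (k + 1))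
      (abs_cutoffWeight_le (k + 1)) hM hε'
    obtain ⟨n, hn1, hn2⟩ := ((hlim k _ hε').and (hlim (k + 1) δ hδ)).exists
    have e : (fun t => localPath (k + 1 + 1) (u n) t * cutoffWeight (k + 1) t) =
        localPath (k + 1) (u n) := by
      funext t
      rw [localPath_eq_mul, localPath_eq_mul, mul_assoc, cutoffWeight_mul_succ]
    have h2 := hmul _ hn2
    rw [e] at h2
    refine (prokhorovDist_triangle _ (localPath (k + 1) (u n)) _).trans ?_
    refine (add_le_add ((prokhorovDist_comm_le _ _).trans hn1.le) h2.le).trans ?_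
    rw [← ENNReal.ofReal_add hε'.le hε'.le, add_halves, zero_add, ENNReal.ofReal_coe_nnreal]
  obtain ⟨x, hx⟩ := exists_localPath_eq hy hcomp
  refine ⟨x, tendsto_of_localDist fun k => ?_⟩
  rw [Metric.tendsto_nhds]
  intro ε hε
  filter_upwards [hlim k ε hε] with n hn
  rw [Real.dist_eq, sub_zero, abs_of_nonneg (localDist_nonneg _ _ _), localDist_lt_iff, hx]
  exact hn

/-! ### Uniform closeness on bounded time intervals -/

lemma localDist_le_of_forall_le {k : ℕ} {x y : SkorokhodSpace} {ε : ℝ} (hε : 0 ≤ ε)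
    (h : ∀ t : ℝ≥0, t ≤ k + 1 → |x t - y t| ≤ ε) : localDist k x y ≤ ε := by
  refine localDist_le_of_le hε ?_
  rw [← add_zero ε]
  refine prokhorovDist_le (OrderIso.refl _) hε le_rfl (fun u => ?_) (by simp [logSlope_refl])
  rw [OrderIso.refl_apply, localPath_eq_mul, localPath_eq_mul, ← sub_mul, abs_mul]
  rcases le_or_gt u (timeScaleInv (k + 1)) with hu | hu
  · have hu1 : u ≠ 1 := (hu.trans_lt (timeScaleInv_lt_one _)).ne
    calc _ ≤ ε * 1 := mul_le_mul (h _ ((timeScale_le_iff hu1).2 hu)) (abs_cutoffWeight_le _ _)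
          (abs_nonneg _) hε
      _ = ε := mul_one ε
  · simpa [cutoffWeight_eq_zero hu] using hε

/-- Paths that are uniformly close on a long time interval are close in `D`. -/
lemma exists_nat_dist_lt {ε : ℝ} (hε : 0 < ε) :
    ∃ n : ℕ, ∀ x y : SkorokhodSpace,
      (∀ t : ℝ≥0, t ≤ n → |x t - y t| ≤ 1 / ((n : ℝ) + 1)) → dist x y < ε := by
  -- Counterexamples for every `n` would be two sequences whose local distances all tend to `0`,
  -- hence whose distance does too.
  by_contra! hcon
  choose x y hxy hd using hcon
  have key : Tendsto (fun n => dist (x n) (y n)) atTop (𝓝 0) := by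
    refine tendsto_dist_of_localDist fun k => ?_
    refine squeeze_zero' (Eventually.of_forall fun _ => localDist_nonneg _ _ _) ?_
      tendsto_one_div_add_atTop_nhds_zero_nat
    filter_upwards [eventually_ge_atTop (k + 1 + 1)] with n hn
    refine localDist_le_of_forall_le (by positivity) fun t ht => hxy n t (ht.trans ?_)
    exact_mod_cast hn
  obtain ⟨n, hn⟩ := (key.eventually (gt_mem_nhds hε)).exists
  exact absurd hn (not_lt.2 (hd n))

/-! ### Approximation by step functions -/

lemma isCadlag_comp_floor (g : ℤ → ℝ) : IsCadlag fun s : ℝ => g ⌊s⌋ where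
  right s := by
    have h : Tendsto (fun r : ℝ => g ⌊r⌋) (𝓝[≥] s) (pure (g ⌊s⌋)) :=
      (tendsto_pure_pure g _).comp (tendsto_floor_right_pure_floor s)
    exact (h.mono_right (pure_le_nhds _)).mono_left (nhdsWithin_mono _ Ioi_subset_Ici_self)
  left s := by
    have h : Tendsto (fun r : ℝ => g ⌊r⌋) (𝓝[<] s) (pure (g (⌈s⌉ - 1))) :=
      (tendsto_pure_pure g _).comp (tendsto_floor_left_pure_ceil_sub_one s)
    exact ⟨_, h.mono_right (pure_le_nhds _)⟩

/-- The step function with values `v i` on the time intervals that correspond to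
`[i / (m + 1), (i + 1) / (m + 1))`. -/
noncomputable def stepPath (m : ℕ) (v : Fin (m + 1) → ℝ) : SkorokhodSpace where
  toFun t := v (Fin.ofNat (m + 1) ⌊((m : ℝ) + 1) * timeScaleInv t⌋.toNat)
  right_continuous := ((isCadlag_comp_floor fun j => v (Fin.ofNat (m + 1) j.toNat)).comp
    (f := fun t : ℝ≥0 => ((m : ℝ) + 1) * timeScaleInv t)
    (fun _ _ h => mul_lt_mul_of_pos_left (strictMono_timeScaleInv h) (by positivity))
    (continuous_const.mul (continuous_subtype_val.comp continuous_timeScaleInv))).right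
  left_limits := ((isCadlag_comp_floor fun j => v (Fin.ofNat (m + 1) j.toNat)).comp
    (f := fun t : ℝ≥0 => ((m : ℝ) + 1) * timeScaleInv t)
    (fun _ _ h => mul_lt_mul_of_pos_left (strictMono_timeScaleInv h) (by positivity))
    (continuous_const.mul (continuous_subtype_val.comp continuous_timeScaleInv))).left

lemma stepPath_apply (m : ℕ) (v : Fin (m + 1) → ℝ) (t : ℝ≥0) :
    stepPath m v t = v (Fin.ofNat (m + 1) ⌊((m : ℝ) + 1) * timeScaleInv t⌋.toNat) := rfl

lemma continuous_stepPath (m : ℕ) : Continuous (stepPath m) := by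
  refine Metric.continuous_iff.2 fun v ε hε => ?_
  obtain ⟨n, hn⟩ := exists_nat_dist_lt hε
  refine ⟨1 / ((n : ℝ) + 1), by positivity, fun w hw => hn _ _ fun t _ => ?_⟩
  exact (dist_le_pi_dist w v _).trans hw.le

/-- The grid point of mesh `1 / (m + 1)` to the left of `u`. -/
noncomputable def gridPoint (m : ℕ) (u : unitInterval) : unitInterval :=
  ⟨⌊((m : ℝ) + 1) * u⌋ / ((m : ℝ) + 1), by
    have h0 : (0 : ℤ) ≤ ⌊((m : ℝ) + 1) * u⌋ := Int.floor_nonneg.2 (mul_nonneg (by positivity) u.2.1)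
    have h0' : (0 : ℝ) ≤ ⌊((m : ℝ) + 1) * u⌋ := by exact_mod_cast h0
    have h1 := Int.floor_le (((m : ℝ) + 1) * u)
    have h2 := u.2.2
    refine ⟨by positivity, ?_⟩
    rw [div_le_one (by positivity)]
    nlinarith⟩

lemma coe_gridPoint (m : ℕ) (u : unitInterval) :
    (gridPoint m u : ℝ) = ⌊((m : ℝ) + 1) * u⌋ / ((m : ℝ) + 1) := rfl

lemma gridPoint_le (m : ℕ) (u : unitInterval) : gridPoint m u ≤ u := by
  refine Subtype.coe_le_coe.1 ?_
  rw [coe_gridPoint, div_le_iff₀ (by positivity), mul_comm]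
  exact Int.floor_le _

lemma sub_gridPoint_lt (m : ℕ) (u : unitInterval) :
    (u : ℝ) - gridPoint m u < 1 / ((m : ℝ) + 1) := by
  have h := Int.lt_floor_add_one (((m : ℝ) + 1) * u)
  rw [coe_gridPoint, sub_lt_iff_lt_add, ← add_div, lt_div_iff₀ (by positivity)]
  linarith

/-- The values of a path at the times of the grid of mesh `1 / (m + 1)`. -/
noncomputable def gridValues (m : ℕ) (x : SkorokhodSpace) (i : Fin (m + 1)) : ℝ :=
  x (Real.toNNReal (-Real.log (1 - (i : ℝ) / ((m : ℝ) + 1))))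

lemma stepPath_gridValues (m : ℕ) (x : SkorokhodSpace) (t : ℝ≥0) :
    stepPath m (gridValues m x) t = x (timeScale (gridPoint m (timeScaleInv t))) := by
  rw [stepPath_apply, gridValues, timeScale, coe_gridPoint]
  have h0 : (0 : ℤ) ≤ ⌊((m : ℝ) + 1) * timeScaleInv t⌋ :=
    Int.floor_nonneg.2 (mul_nonneg (by positivity) (timeScaleInv t).2.1)
  have h1 : ⌊((m : ℝ) + 1) * timeScaleInv t⌋ < m + 1 := by
    refine Int.floor_lt.2 ?_
    have : (timeScaleInv t : ℝ) < 1 := timeScaleInv_lt_one t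
    push_cast
    nlinarith [(Nat.cast_nonneg m : (0 : ℝ) ≤ m)]
  generalize ⌊((m : ℝ) + 1) * timeScaleInv t⌋ = j at h0 h1
  lift j to ℕ using h0
  -- `Fin.ofNat` reduces modulo `m + 1`, but `timeScaleInv t < 1` keeps the index below that.
  have hj : j % (m + 1) = j := Nat.mod_eq_of_lt (by omega)
  simp [hj]

/-- One-sided limits make the oscillation small on each side of every point; compactness leaves
finitely many points to separate. -/
lemma exists_finset_oscillation_le {y : unitInterval → ℝ} (hy : IsCadlag y) {ε : ℝ}
    (hε : 0 < ε) :
    ∃ F : Finset unitInterval, ∀ s t, (∀ p ∈ F, p ≤ s ↔ p ≤ t) → |y s - y t| ≤ ε := by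
  have hloc : ∀ p, ∃ r > (0 : ℝ), ∀ s t, dist s p < r → dist t p < r → (p ≤ s ↔ p ≤ t) →
      |y s - y t| ≤ ε := by
    intro p
    obtain ⟨l, hl⟩ := hy.left p
    have h1 := eventually_nhdsWithin_iff.1 (Metric.tendsto_nhds.1 hl (ε / 2) (by positivity))
    have h2 := eventually_nhdsWithin_iff.1
      (Metric.tendsto_nhds.1 (hy.right p) (ε / 2) (by positivity))
    obtain ⟨r, hr, h⟩ := Metric.eventually_nhds_iff.1 (h1.and h2)
    have hge : ∀ s, dist s p < r → p ≤ s → |y s - y p| < ε / 2 := by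
      intro s hs hps
      rcases hps.eq_or_lt with rfl | hlt
      · simpa using hε
      · exact (h hs).2 hlt
    refine ⟨r, hr, fun s t hs ht hst => ?_⟩
    by_cases hps : p ≤ s
    · have e1 := abs_lt.1 (hge s hs hps)
      have e2 := abs_lt.1 (hge t ht (hst.1 hps))
      rw [abs_le]; constructor <;> linarith
    · have e1 := abs_lt.1 ((h hs).1 (not_le.1 hps))
      have e2 := abs_lt.1 ((h ht).1 (not_le.1 fun h' => hps (hst.2 h')))
      rw [abs_le]; constructor <;> linarith
  choose r hr h using hloc
  obtain ⟨T, -, hT⟩ := (isCompact_univ (X := unitInterval)).elim_nhds_subcover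
    (fun p => Metric.ball p (r p)) fun p _ => Metric.ball_mem_nhds p (hr p)
  -- Adding the right ends `p + r p` forces `t ≥ s` into the ball around `p` that contains `s`.
  -- Clipping is harmless: the right end matters only when `p + r p ≤ t ≤ 1`.
  refine ⟨T ∪ T.image fun p => projIcc (0 : ℝ) 1 zero_le_one (p + r p), ?_⟩
  have key : ∀ s t, s ≤ t → (∀ p ∈ T ∪ T.image fun p => projIcc (0 : ℝ) 1 zero_le_one (p + r p),
      p ≤ s ↔ p ≤ t) → |y s - y t| ≤ ε := by
    intro s t hst hp
    obtain ⟨p, hpT, hps⟩ := mem_iUnion₂.1 (hT (mem_univ s))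
    have hst' : (s : ℝ) ≤ t := hst
    have ht1 := t.2.2
    have hps' := abs_lt.1 (show |(s : ℝ) - p| < r p from hps)
    refine h p s t hps ?_ (hp p (Finset.mem_union_left _ hpT))
    change |(t : ℝ) - p| < r p
    rw [abs_lt]
    refine ⟨by linarith, ?_⟩
    by_contra hcon
    have hq := hp _ (Finset.mem_union_right _ (Finset.mem_image_of_mem _ hpT))
    have hle : (p : ℝ) + r p ≤ t := by linarith
    rw [projIcc_of_mem zero_le_one ⟨add_nonneg p.2.1 (hr p).le, hle.trans ht1⟩] at hq
    have : (p : ℝ) + r p ≤ s := hq.2 hle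
    linarith
  intro s t hst
  rcases le_total s t with hle | hle
  · exact key s t hle hst
  · rw [abs_sub_comm]
    exact key t s hle fun p hp => (hst p hp).symm

/-- The shift of `p` to the next grid point is at most the mesh, and points of a finite set are
`δ`-separated. So the shift is Lipschitz there with constant mesh`/ δ`, extends to `ℝ` with the same
constant, and its sum with the identity has slopes near `1`. -/
lemma exists_timeChange_grid (F : Finset unitInterval) {ε : ℝ} (hε : 0 < ε) :
    ∀ᶠ m : ℕ in atTop, ∃ μ : unitInterval ≃o unitInterval,
      logSlope μ ≤ ENNReal.ofReal ε ∧
        ∀ p ∈ F, (μ p : ℝ) = ⌈((m : ℝ) + 1) * p⌉ / ((m : ℝ) + 1) := by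
  let S : Finset ℝ := insert 0 (insert 1 (F.image Subtype.val))
  obtain ⟨δ, hδ, hS⟩ : ∃ δ > (0 : ℝ), ∀ p ∈ S, ∀ q ∈ S, p ≠ q → δ ≤ dist p q := by
    have hnt : (S : Set ℝ).Nontrivial :=
      ⟨0, by simp [S], 1, by simp [S], zero_ne_one⟩
    exact ⟨_, S.finite_toSet.infsep_pos_iff_nontrivial.2 hnt,
      fun p hp q hq => infsep_le_dist_of_mem hp hq⟩
  have hexp : Real.exp (-ε) < 1 := by simpa using hε
  have hlim : Tendsto (fun m : ℕ => 1 / ((m : ℝ) + 1) / δ) atTop (𝓝 0) := by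
    simpa using (tendsto_one_div_add_atTop_nhds_zero_nat (𝕜 := ℝ)).div_const δ
  filter_upwards [hlim.eventually (gt_mem_nhds (sub_pos.2 hexp))] with m hm
  set c : ℝ → ℝ := fun p => ⌈((m : ℝ) + 1) * p⌉ / ((m : ℝ) + 1) - p with hc
  have hm0 : (0 : ℝ) < (m : ℝ) + 1 := by positivity
  have hc0 : ∀ p, 0 ≤ c p ∧ c p ≤ 1 / ((m : ℝ) + 1) := by
    intro p
    have h1 := Int.le_ceil (((m : ℝ) + 1) * p)
    have h2 := Int.ceil_lt_add_one (((m : ℝ) + 1) * p)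
    simp only [hc]
    constructor
    · rw [sub_nonneg, le_div_iff₀ hm0]; linarith
    · rw [sub_le_iff_le_add, div_add' _ _ _ hm0.ne', div_le_div_iff_of_pos_right hm0]; linarith
  have hK : (0 : ℝ) ≤ 1 / ((m : ℝ) + 1) / δ := by positivity
  have hlip : LipschitzOnWith (1 / ((m : ℝ) + 1) / δ).toNNReal c S := by
    refine LipschitzOnWith.of_dist_le_mul fun p hp q hq => ?_
    rw [Real.coe_toNNReal _ hK]
    rcases eq_or_ne p q with rfl | hpq
    · simp
    · have h1 : dist (c p) (c q) ≤ 1 / ((m : ℝ) + 1) := by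
        rw [Real.dist_eq, abs_le]
        have := hc0 p
        have := hc0 q
        constructor <;> linarith
      refine h1.trans ?_
      rw [div_mul_eq_mul_div, le_div_iff₀ hδ]
      exact mul_le_mul_of_nonneg_left (hS p hp q hq hpq) (by positivity)
  obtain ⟨g, hg, hgc⟩ := hlip.extend_real
  obtain ⟨μ, hμ, hμs⟩ := exists_timeChange (f := fun t => (t : ℝ) + g t) hε.le
    (by
      rw [← hgc (show ((0 : unitInterval) : ℝ) ∈ (S : Set ℝ) by simp [S])]
      simp [hc])
    (by
      rw [← hgc (show ((1 : unitInterval) : ℝ) ∈ (S : Set ℝ) by simp [S])]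
      have : ⌈(m : ℝ) + 1⌉ = (m : ℤ) + 1 := by
        exact_mod_cast Int.ceil_natCast (m + 1)
      simp only [hc, Set.Icc.coe_one, mul_one, this]
      push_cast
      rw [div_self hm0.ne']
      ring)
    (by
      intro s t hst
      have hst' : (s : ℝ) < t := hst
      have h1 := hg.dist_le_mul (t : ℝ) s
      rw [Real.coe_toNNReal _ hK, Real.dist_eq, Real.dist_eq, abs_of_pos (sub_pos.2 hst')] at h1
      have h2 := abs_le.1 h1
      have h3 := Real.add_one_le_exp ε
      have h4 := Real.add_one_le_exp (-ε)
      constructor <;> nlinarith)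
  refine ⟨μ, hμs, fun p hp => ?_⟩
  rw [hμ, ← hgc (show (p : ℝ) ∈ (S : Set ℝ) by
    simp only [S, Finset.coe_insert, Finset.coe_image, mem_insert_iff, mem_image]
    exact Or.inr (Or.inr ⟨p, hp, rfl⟩))]
  simp [hc]

lemma eventually_prokhorovDist_gridPoint_le {y : unitInterval → ℝ} (hy : IsCadlag y) {ε : ℝ}
    (hε : 0 < ε) :
    ∀ᶠ m : ℕ in atTop, prokhorovDist y (fun u => y (gridPoint m u)) ≤ ENNReal.ofReal ε := by
  obtain ⟨F, hF⟩ := exists_finset_oscillation_le hy (half_pos hε)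
  filter_upwards [exists_timeChange_grid F (half_pos hε)] with m hm
  obtain ⟨μ, hμs, hμ⟩ := hm
  rw [← add_halves ε]
  -- As `μ p` is a grid point, `μ p ≤ μ t` holds exactly when `μ p` is at most the grid point left
  -- of `μ t`. So `t` and that grid point lie on the same side of every `p ∈ F`.
  refine prokhorovDist_le μ (half_pos hε).le (half_pos hε).le (fun t => hF _ _ fun p hp => ?_) hμs
  have hm0 : (0 : ℝ) < (m : ℝ) + 1 := by positivity
  rw [← μ.le_iff_le, ← Subtype.coe_le_coe, ← Subtype.coe_le_coe, hμ p hp, coe_gridPoint,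
    div_le_iff₀ hm0, le_div_iff₀ hm0, mul_comm (μ t : ℝ), mul_comm (p : ℝ), ← Int.le_floor,
    Int.ceil_le]

lemma tendsto_stepPath_gridValues (x : SkorokhodSpace) :
    Tendsto (fun m => stepPath m (gridValues m x)) atTop (𝓝 x) := by
  refine tendsto_of_localDist fun k => ?_
  rw [Metric.tendsto_nhds]
  intro ε hε
  obtain ⟨M, hM⟩ := x.bounded_Iic ((k + 1 : ℕ) + 1)
  have hM0 : 0 ≤ M := (abs_nonneg _).trans (hM 0 zero_le)
  obtain ⟨r, hr, hrw⟩ := Metric.uniformContinuous_iff.1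
    (CompactSpace.uniformContinuous_of_continuous (continuous_cutoffWeight (k + 1)))
    (ε / (4 * (M + 1))) (by positivity)
  filter_upwards [eventually_prokhorovDist_gridPoint_le (isCadlag_localPath (k + 1) x)
    (show 0 < ε / 4 by positivity),
    (tendsto_one_div_add_atTop_nhds_zero_nat (𝕜 := ℝ)).eventually (gt_mem_nhds hr)] with m hm hmr
  rw [Real.dist_eq, sub_zero, abs_of_nonneg (localDist_nonneg _ _ _), localDist_lt_iff]
  -- The two functions use the same values of `x`, with the cutoff taken at `u` in one and at the
  -- grid point in the other; uniform continuity of the cutoff compares them.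
  have h1 : prokhorovDist (localPath (k + 1) (stepPath m (gridValues m x)))
      (fun u => localPath (k + 1) x (gridPoint m u)) ≤ ENNReal.ofReal (ε / 4 + 0) := by
    refine prokhorovDist_le (OrderIso.refl _) (by positivity) le_rfl (fun u => ?_)
      (by simp [logSlope_refl])
    rw [OrderIso.refl_apply, localPath_eq_mul, localPath_eq_mul]
    have hgu := gridPoint_le m u
    by_cases hu : u = 1
    · have hg1 : gridPoint m u = 1 := by
        refine Subtype.ext ?_
        have : ⌊(m : ℝ) + 1⌋ = (m : ℤ) + 1 := by
          exact_mod_cast Int.floor_natCast (m + 1)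
        rw [coe_gridPoint, hu, Set.Icc.coe_one, mul_one, this]
        push_cast
        exact div_self (by positivity)
      rw [hg1, hu]
      simp [cutoffWeight]
      positivity
    · rw [stepPath_gridValues, timeScaleInv_timeScale hu, ← mul_sub, abs_mul]
      rcases le_or_gt (gridPoint m u) (timeScaleInv ((k + 1 : ℕ) + 1)) with h | h
      · have hg1 : gridPoint m u ≠ 1 := (h.trans_lt (timeScaleInv_lt_one _)).ne
        have hd : dist (cutoffWeight (k + 1) u) (cutoffWeight (k + 1) (gridPoint m u)) <
            ε / (4 * (M + 1)) := by
          refine hrw ?_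
          rw [Subtype.dist_eq, Real.dist_eq,
            abs_of_nonneg (sub_nonneg.2 (show (gridPoint m u : ℝ) ≤ u from hgu))]
          exact (sub_gridPoint_lt m u).trans hmr
        refine (mul_le_mul (hM _ ((timeScale_le_iff hg1).2 h)) hd.le (abs_nonneg _) hM0).trans ?_
        rw [mul_div_assoc', div_le_div_iff₀ (by positivity) (by positivity)]
        nlinarith
      · rw [cutoffWeight_eq_zero h, cutoffWeight_eq_zero (h.trans_le hgu)]
        simp
        positivity
  refine (prokhorovDist_triangle _ (fun u => localPath (k + 1) x (gridPoint m u)) _).trans_lt ?_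
  refine (add_le_add h1 ((prokhorovDist_comm_le _ _).trans hm)).trans_lt ?_
  rw [← ENNReal.ofReal_add (by positivity) (by positivity)]
  exact (ENNReal.ofReal_lt_ofReal_iff hε).2 (by linarith)

/-! ### Tightness of a single process up to `ε` -/

section SingleLaw

variable {Ω : Type*} [MeasurableSpace Ω]

lemma measurable_dist_of_measurable_eval {V : Ω → SkorokhodSpace}
    (hV : ∀ t, Measurable fun ω => V ω t) (d : SkorokhodSpace) :
    Measurable fun ω => dist (V ω) d := by
  refine measurable_of_tendsto_metrizable
    (f := fun m ω => dist (stepPath m (gridValues m (V ω))) d) (fun m => ?_)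
    (tendsto_pi_nhds.2 fun ω => (tendsto_stepPath_gridValues (V ω)).dist tendsto_const_nhds)
  have h1 : Measurable fun v : Fin (m + 1) → ℝ => dist (stepPath m v) d :=
    ((continuous_stepPath m).dist continuous_const).measurable
  exact h1.comp (measurable_pi_lambda _ fun i => hV _)

/-- A countable dense family in `D`. -/
noncomputable def denseSteps (p : ℕ × ℕ) : SkorokhodSpace :=
  stepPath p.1 (TopologicalSpace.denseSeq (Fin (p.1 + 1) → ℝ) p.2)

lemma exists_dist_denseSteps_lt (x : SkorokhodSpace) {ε : ℝ} (hε : 0 < ε) :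
    ∃ j : ℕ, dist x (denseSteps j.unpair) < ε := by
  obtain ⟨m, hm⟩ := ((Metric.tendsto_nhds.1 (tendsto_stepPath_gridValues x)) (ε / 2)
    (half_pos hε)).exists
  have hopen : IsOpen {v : Fin (m + 1) → ℝ | dist (stepPath m v) x < ε} :=
    isOpen_lt ((continuous_stepPath m).dist continuous_const) continuous_const
  obtain ⟨i, hi⟩ := (TopologicalSpace.denseRange_denseSeq (Fin (m + 1) → ℝ)).exists_mem_open hopen
    ⟨_, hm.trans (half_lt_self hε)⟩
  refine ⟨Nat.pair m i, ?_⟩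
  rw [dist_comm, Nat.unpair_pair]
  exact hi

/-- Countably many balls centred at dense step paths cover `D`; continuity from above along finite
subfamilies does the rest. -/
lemma exists_finite_cover_measure_le (P : Measure Ω) [IsFiniteMeasure P]
    {V : Ω → SkorokhodSpace} (hV : ∀ t, Measurable fun ω => V ω t) {ε : ℝ} (hε : 0 < ε)
    {e : ℝ≥0∞} (he : 0 < e) :
    ∃ t : Set SkorokhodSpace, t.Finite ∧ P {ω | V ω ∉ ⋃ y ∈ t, Metric.ball y ε} ≤ e := by
  let A : ℕ → Set Ω := fun N => ⋂ i ∈ Finset.range N, {ω | ε ≤ dist (V ω) (denseSteps i.unpair)}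
  have hA : ∀ N, MeasurableSet (A N) := fun N =>
    Finset.measurableSet_biInter _ fun i _ =>
      measurableSet_le measurable_const (measurable_dist_of_measurable_eval hV _)
  have hanti : Antitone A := fun N M hNM =>
    biInter_subset_biInter_left fun i hi =>
      Finset.mem_range.2 ((Finset.mem_range.1 hi).trans_le hNM)
  have hempty : ⋂ N, A N = ∅ := by
    refine eq_empty_of_forall_notMem fun ω hω => ?_
    obtain ⟨j, hj⟩ := exists_dist_denseSteps_lt (V ω) hε
    have h1 := mem_iInter₂.1 (mem_iInter.1 hω (j + 1)) j (Finset.self_mem_range_succ j)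
    exact absurd hj (not_lt.2 h1)
  have hlim := tendsto_measure_iInter_atTop (μ := P) (fun N => (hA N).nullMeasurableSet) hanti
    ⟨0, measure_ne_top P _⟩
  rw [hempty, measure_empty] at hlim
  obtain ⟨N, hN⟩ := (hlim.eventually (gt_mem_nhds he)).exists
  refine ⟨(fun i : ℕ => denseSteps i.unpair) '' Finset.range N, (Finset.finite_toSet _).image _,
    (measure_mono fun ω hω => ?_).trans hN.le⟩
  refine mem_iInter₂.2 fun i hi => ?_
  by_contra hcon
  exact hω (mem_iUnion₂.2 ⟨_, ⟨i, hi, rfl⟩, Metric.mem_ball.2 (not_le.1 hcon)⟩)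

end SingleLaw

/-! ### Bounded paths with a uniform modulus of continuity -/

/-- Paths whose oscillation over times at most `δ` apart in `[0, L]` is at most `η`. -/
def modulusLE (L δ : ℝ≥0) (η : ℝ) : Set SkorokhodSpace :=
  {x | ∀ s t : ℝ≥0, s ≤ t → t ≤ L → t ≤ s + δ → |x s - x t| ≤ η}

lemma floor_div_mul_le (t : ℝ≥0) {δ : ℝ≥0} (hδ : 0 < δ) :
    (⌊t / δ⌋₊ : ℝ≥0) * δ ≤ t ∧ t < ((⌊t / δ⌋₊ : ℝ≥0) + 1) * δ := by
  constructor
  · exact (le_div_iff₀ hδ).1 (Nat.floor_le zero_le)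
  · exact (div_lt_iff₀ hδ).1 (Nat.lt_floor_add_one _)

lemma exists_finite_cover_modulusLE {ε : ℝ} (hε : 0 < ε) :
    ∃ L : ℝ≥0, 0 < L ∧ ∃ η : ℝ, 0 < η ∧ ∀ (c : ℝ) (δ : ℝ≥0), 0 < δ →
      ∃ t : Set SkorokhodSpace, t.Finite ∧
        {x | x ∈ modulusLE L δ (3 * η) ∧ ∀ s ≤ L, |x s| ≤ c} ⊆ ⋃ y ∈ t, Metric.ball y ε := by
  obtain ⟨n, hn⟩ := exists_nat_dist_lt hε
  -- The `7` is `3 + 1 + 3`: a modulus for each of two paths, and `η` for equal rounded values at a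
  -- grid time. `L = n + 1` only ensures `0 < L`.
  refine ⟨n + 1, by positivity, 1 / ((n : ℝ) + 1) / 7, by positivity, fun c δ hδ => ?_⟩
  set η : ℝ := 1 / ((n : ℝ) + 1) / 7 with hη
  have hη0 : 0 < η := by positivity
  set S : Set SkorokhodSpace :=
    {x | x ∈ modulusLE (n + 1) δ (3 * η) ∧ ∀ s ≤ (n : ℝ≥0) + 1, |x s| ≤ c} with hS
  rcases S.eq_empty_or_nonempty with hem | ⟨x₀, hx₀⟩
  · exact ⟨∅, finite_empty, by simp [hem]⟩
  have : Nonempty SkorokhodSpace := ⟨x₀⟩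
  let N : ℕ := ⌊((n : ℝ≥0) + 1) / δ⌋₊
  let code : SkorokhodSpace → Fin (N + 1) → ℤ := fun x i => ⌊x ((i : ℕ) * δ) / η⌋
  have hi : ∀ i : Fin (N + 1), ((i : ℕ) : ℝ≥0) * δ ≤ n + 1 := by
    intro i
    refine le_trans ?_ (floor_div_mul_le ((n : ℝ≥0) + 1) hδ).1
    exact mul_le_mul_of_nonneg_right (Nat.cast_le.2 (Nat.lt_succ_iff.1 i.2)) zero_le
  have hfin : (code '' S).Finite := by
    refine (Set.Finite.pi fun _ : Fin (N + 1) =>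
      Set.finite_Icc (⌊-c / η⌋ : ℤ) ⌊c / η⌋).subset ?_
    rintro _ ⟨x, hx, rfl⟩ i -
    have := abs_le.1 (hx.2 _ (hi i))
    exact ⟨Int.floor_le_floor (by gcongr; exact this.1),
      Int.floor_le_floor (by gcongr; exact this.2)⟩
  -- The centres are one path of `S` for each attained code, so they share the modulus bound.
  refine ⟨Function.invFunOn code S '' (code '' S), hfin.image _, fun x hx => ?_⟩
  have hcx : code x ∈ code '' S := mem_image_of_mem _ hx
  refine mem_iUnion₂.2 ⟨_, mem_image_of_mem _ hcx, Metric.mem_ball.2 (hn _ _ fun t ht => ?_)⟩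
  have hz := Function.invFunOn_mem hcx
  have hzc := Function.invFunOn_eq hcx
  generalize Function.invFunOn code S (code x) = z at hz hzc
  obtain ⟨h1, h2⟩ := floor_div_mul_le t hδ
  have htL : t ≤ (n : ℝ≥0) + 1 := ht.trans (by simp)
  have hiN : ⌊t / δ⌋₊ < N + 1 := Nat.lt_succ_iff.2 (Nat.floor_mono (by gcongr))
  have h3 : t ≤ (⌊t / δ⌋₊ : ℝ≥0) * δ + δ := by rw [← add_one_mul]; exact h2.le
  have e1 := abs_le.1 (hx.1 _ t h1 htL h3)
  have e2 := abs_le.1 (hz.1 _ t h1 htL h3)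
  have e3 : ⌊z ((⌊t / δ⌋₊ : ℝ≥0) * δ) / η⌋ = ⌊x ((⌊t / δ⌋₊ : ℝ≥0) * δ) / η⌋ :=
    congrFun hzc ⟨_, hiN⟩
  have e4 := abs_lt.1 (Int.abs_sub_lt_one_of_floor_eq_floor e3)
  rw [← sub_div, lt_div_iff₀ hη0, div_lt_iff₀ hη0] at e4
  have e5 : 1 / ((n : ℝ) + 1) = 7 * η := by rw [hη]; ring
  rw [e5, abs_le]
  constructor <;> linarith

lemma abs_sub_lt_of_oscAfter_lt {x : SkorokhodSpace} {s t δ : ℝ≥0} {η : ℝ}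
    (h : oscAfter x s δ < ENNReal.ofReal η) (hst : s ≤ t) (ht : t ≤ s + δ) : |x t - x s| < η := by
  have h1 : ‖x (s + (t - s)) - x s‖ₑ ≤ oscAfter x s δ :=
    le_iSup₂ (f := fun t (_ : t ∈ Iic δ) => ‖x (s + t) - x s‖ₑ) (t - s)
      (tsub_le_iff_left.2 ht)
  rw [add_tsub_cancel_of_le hst, Real.enorm_eq_ofReal_abs] at h1
  exact lt_of_not_ge fun hcon => absurd (h1.trans_lt h) (not_lt.2 (ENNReal.ofReal_le_ofReal hcon))

/-- Times at most `δ` apart lie in the same or adjacent grid intervals, so at most three increments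
from grid times are chained. -/
lemma mem_modulusLE_of_oscAfter_lt {x : SkorokhodSpace} {L δ : ℝ≥0} (hδ : 0 < δ) {η : ℝ}
    (h : ∀ i ∈ Finset.range (⌊L / δ⌋₊ + 1), oscAfter x (i * δ) δ < ENNReal.ofReal η) :
    x ∈ modulusLE L δ (3 * η) := by
  intro s t hst htL hts
  obtain ⟨h1, h2⟩ := floor_div_mul_le s hδ
  have hiN : ⌊s / δ⌋₊ ∈ Finset.range (⌊L / δ⌋₊ + 1) :=
    Finset.mem_range.2 (Nat.lt_succ_iff.2 (Nat.floor_mono (by gcongr; exact hst.trans htL)))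
  set i := ⌊s / δ⌋₊
  have h3 : s ≤ (i : ℝ≥0) * δ + δ := by rw [← add_one_mul]; exact h2.le
  have e1 := abs_lt.1 (abs_sub_lt_of_oscAfter_lt (h i hiN) h1 h3)
  rcases le_total t ((i : ℝ≥0) * δ + δ) with hcase | hcase
  · have e2 := abs_lt.1 (abs_sub_lt_of_oscAfter_lt (h i hiN) (h1.trans hst) hcase)
    rw [abs_le]
    constructor <;> linarith
  · have hi1 : (i : ℝ≥0) * δ + δ = ((i + 1 : ℕ) : ℝ≥0) * δ := by push_cast; ring
    have hiN1 : i + 1 ∈ Finset.range (⌊L / δ⌋₊ + 1) := by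
      refine Finset.mem_range.2 (Nat.lt_succ_iff.2 (Nat.le_floor ?_))
      rw [le_div_iff₀ hδ, ← hi1]
      exact hcase.trans htL
    have e2 := abs_lt.1 (abs_sub_lt_of_oscAfter_lt (h i hiN) le_self_add le_rfl)
    have e3 := abs_lt.1 (abs_sub_lt_of_oscAfter_lt (h (i + 1) hiN1) (hi1 ▸ hcase)
      (hts.trans (by rw [← hi1]; gcongr)))
    rw [← hi1] at e3
    rw [abs_le]
    constructor <;> linarith

lemma abs_le_of_runningSup_lt {x : SkorokhodSpace} {L : ℝ≥0} {c : ℝ}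
    (h : runningSup x L < ENNReal.ofReal c) {s : ℝ≥0} (hs : s ≤ L) : |x s| ≤ c := by
  have h1 : ‖x s‖ₑ ≤ runningSup x L := le_iSup₂ (f := fun s (_ : s ∈ Iic L) => ‖x s‖ₑ) s hs
  rw [Real.enorm_eq_ofReal_abs] at h1
  exact le_of_not_ge fun hcon => absurd (h1.trans_lt h) (not_lt.2 (ENNReal.ofReal_le_ofReal hcon))

/-! ### Exponential bounds -/

section Probability

variable {Ω : Type*} [mΩ : MeasurableSpace Ω] {P : Measure Ω}

lemma logProb_le_iff {n : ℕ} (hn : 1 ≤ n) (A : Set Ω) (b : ℝ) :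
    logProb P n A ≤ (b : EReal) ↔ P A ≤ ENNReal.ofReal (Real.exp (n * b)) := by
  have hn0 : (0 : ℝ) < n := by exact_mod_cast hn
  have hb : (b : EReal) = ENNReal.log (ENNReal.ofReal (Real.exp b)) := by
    rw [ENNReal.log_ofReal_of_pos (Real.exp_pos b), Real.log_exp]
  rw [logProb, ← ENNReal.log_rpow, hb, ENNReal.log_le_log_iff, ENNReal.rpow_inv_le_iff hn0,
    ENNReal.ofReal_rpow_of_pos (Real.exp_pos b), ← Real.exp_mul, mul_comm b]

/-- Covers of radius `1 / (k + 1)` at level `C + k + 1` have exceptional probabilities summing to at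
most `exp (-nC)`, since `n ≥ 1` and `e ≥ 2`. The bound is required for all `n ≥ 1`, as a threshold
on `n` could depend on `k`. -/
lemma isExponentiallyTight_of_finite_cover {X : ℕ → Ω → SkorokhodSpace}
    (h : ∀ (C ε : ℝ), 0 < ε → ∃ t : Set SkorokhodSpace, t.Finite ∧ ∀ n ≥ 1,
      P {ω | X n ω ∉ ⋃ y ∈ t, Metric.ball y ε} ≤ ENNReal.ofReal (Real.exp (n * -C))) :
    IsExponentiallyTight P X := by
  intro C
  choose t ht hP using fun k : ℕ => h (C + (k + 1)) (1 / ((k : ℝ) + 1)) (by positivity)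
  let S : Set SkorokhodSpace := ⋂ k, ⋃ y ∈ t k, Metric.ball y (1 / ((k : ℝ) + 1))
  have hS : TotallyBounded S := by
    refine Metric.totallyBounded_iff.2 fun ε hε => ?_
    obtain ⟨k, hk⟩ := exists_nat_one_div_lt hε
    exact ⟨t k, ht k, (iInter_subset _ k).trans
      (iUnion₂_mono fun y _ => Metric.ball_subset_ball hk.le)⟩
  refine ⟨closure S, hS.closure.isCompact_of_isClosed isClosed_closure, ?_⟩
  refine limsup_le_of_le (h := ?_)
  filter_upwards [eventually_ge_atTop 1] with n hn
  rw [logProb_le_iff hn]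
  have hsub : {ω | X n ω ∉ closure S} ⊆
      ⋃ k, {ω | X n ω ∉ ⋃ y ∈ t k, Metric.ball y (1 / ((k : ℝ) + 1))} := by
    intro ω hω
    by_contra hcon
    refine hω (subset_closure (mem_iInter.2 fun k => ?_))
    by_contra hk
    exact hcon (mem_iUnion.2 ⟨k, hk⟩)
  have hterm : ∀ k : ℕ, ENNReal.ofReal (Real.exp (n * -(C + (k + 1)))) ≤
      ENNReal.ofReal (Real.exp (n * -C)) * ENNReal.ofReal (1 / 2 / 2 ^ k) := by
    intro k
    rw [← ENNReal.ofReal_mul (Real.exp_pos _).le]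
    refine ENNReal.ofReal_le_ofReal ?_
    have e1 : (n : ℝ) * -(C + (k + 1)) = n * -C + -(n * (k + 1)) := by ring
    rw [e1, Real.exp_add]
    refine mul_le_mul_of_nonneg_left ?_ (Real.exp_pos _).le
    have hn1 : (1 : ℝ) ≤ n := by exact_mod_cast hn
    have e2 : -((n : ℝ) * (k + 1)) ≤ -((k + 1 : ℕ) : ℝ) := by
      push_cast
      nlinarith [(Nat.cast_nonneg k : (0 : ℝ) ≤ k)]
    refine (Real.exp_le_exp.2 e2).trans ?_
    have e3 : (2 : ℝ) ^ (k + 1) ≤ Real.exp ((k + 1 : ℕ) : ℝ) := by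
      rw [← mul_one ((k + 1 : ℕ) : ℝ), Real.exp_nat_mul]
      gcongr
      have := Real.add_one_le_exp (1 : ℝ)
      linarith
    rw [Real.exp_neg, div_div, ← pow_succ', one_div]
    gcongr
  have hsum : ∑' k : ℕ, ENNReal.ofReal (1 / 2 / 2 ^ k) = 1 := by
    have h2 := hasSum_geometric_two' (1 : ℝ)
    rw [← ENNReal.ofReal_tsum_of_nonneg (fun k => by positivity) h2.summable, h2.tsum_eq,
      ENNReal.ofReal_one]
  calc P {ω | X n ω ∉ closure S}
      ≤ ∑' k : ℕ, P {ω | X n ω ∉ ⋃ y ∈ t k, Metric.ball y (1 / ((k : ℝ) + 1))} :=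
        (measure_mono hsub).trans (measure_iUnion_le _)
    _ ≤ ∑' k : ℕ, ENNReal.ofReal (Real.exp (n * -C)) * ENNReal.ofReal (1 / 2 / 2 ^ k) :=
        ENNReal.tsum_le_tsum fun k => (hP k n hn).trans (hterm k)
    _ = ENNReal.ofReal (Real.exp (n * -C)) := by rw [ENNReal.tsum_mul_left, hsum, mul_one]

lemma eventually_measure_le_of_limsup_lt {A : ℕ → Set Ω} {C : ℝ}
    (h : limsup (fun n => logProb P n (A n)) atTop < ((-C : ℝ) : EReal)) :
    ∀ᶠ n : ℕ in atTop, P (A n) ≤ ENNReal.ofReal (Real.exp (n * -C)) := by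
  filter_upwards [eventually_lt_of_limsup_lt h, eventually_ge_atTop 1] with n h1 h2
  exact (logProb_le_iff h2 _ _).1 h1.le

/-- A fixed number of events does not change the exponential rate. -/
lemma eventually_nat_mul_exp_le (N : ℕ) (C : ℝ) :
    ∀ᶠ n : ℕ in atTop, (N : ℝ≥0∞) * ENNReal.ofReal (Real.exp (n * -(C + 1))) ≤
      ENNReal.ofReal (Real.exp (n * -C)) := by
  have hlim : Tendsto (fun n : ℕ => Real.exp n) atTop atTop :=
    Real.tendsto_exp_atTop.comp tendsto_natCast_atTop_atTop
  filter_upwards [hlim.eventually_ge_atTop (N : ℝ)] with n hn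
  rw [← ENNReal.ofReal_natCast, ← ENNReal.ofReal_mul (Nat.cast_nonneg _)]
  refine ENNReal.ofReal_le_ofReal ?_
  calc (N : ℝ) * Real.exp (n * -(C + 1)) ≤ Real.exp n * Real.exp (n * -(C + 1)) := by gcongr
    _ = Real.exp (n * -C) := by rw [← Real.exp_add]; congr 1; ring

lemma exists_eventually_measure_modulusLE_compl_le {𝔽 : ℕ → Filtration ℝ≥0 mΩ}
    {X : ℕ → Ω → SkorokhodSpace} {L : ℝ≥0} {η : ℝ}
    (h : Tendsto
      (fun δ : ℝ≥0 => limsup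
        (fun n : ℕ => ⨆ τ ∈ boundedStoppingTimes (𝔽 n) L,
          logProb P n {ω | ENNReal.ofReal η ≤ oscAfter (X n ω) (τ ω) δ}) atTop)
      (𝓝[>] 0) (𝓝 ⊥)) (C : ℝ) :
    ∃ δ : ℝ≥0, 0 < δ ∧ ∀ᶠ n : ℕ in atTop,
      P {ω | X n ω ∉ modulusLE L δ (3 * η)} ≤ ENNReal.ofReal (Real.exp (n * -C)) := by
  obtain ⟨δ, hδ, hδ0⟩ := ((h.eventually (gt_mem_nhds (EReal.bot_lt_coe (-(C + 1))))).and
    self_mem_nhdsWithin).exists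
  refine ⟨δ, hδ0, ?_⟩
  have hδ0' : 0 < δ := hδ0
  set N := ⌊L / δ⌋₊ + 1 with hN
  filter_upwards [eventually_lt_of_limsup_lt hδ, eventually_nat_mul_exp_le N C,
    eventually_ge_atTop 1] with n hn1 hn2 hn3
  have hi : ∀ i ∈ Finset.range N,
      P {ω | ENNReal.ofReal η ≤ oscAfter (X n ω) (i * δ) δ} ≤
        ENNReal.ofReal (Real.exp (n * -(C + 1))) := by
    intro i hi
    rw [← logProb_le_iff hn3]
    refine le_trans (le_iSup₂ (f := fun τ (_ : τ ∈ boundedStoppingTimes (𝔽 n) L) =>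
      logProb P n {ω | ENNReal.ofReal η ≤ oscAfter (X n ω) (τ ω) δ}) (fun _ => (i : ℝ≥0) * δ)
      ⟨isStoppingTime_const _ _, fun _ => ?_⟩) hn1.le
    refine le_trans ?_ (floor_div_mul_le L hδ0').1
    exact mul_le_mul_of_nonneg_right
      (Nat.cast_le.2 (Nat.lt_succ_iff.1 (Finset.mem_range.1 hi))) zero_le
  calc P {ω | X n ω ∉ modulusLE L δ (3 * η)}
      ≤ P (⋃ i ∈ Finset.range N, {ω | ENNReal.ofReal η ≤ oscAfter (X n ω) (i * δ) δ}) := by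
        refine measure_mono fun ω hω => ?_
        by_contra hcon
        refine hω (mem_modulusLE_of_oscAfter_lt hδ0' fun i hi => ?_)
        exact lt_of_not_ge fun hge => hcon (mem_iUnion₂.2 ⟨i, hi, hge⟩)
    _ ≤ ∑ i ∈ Finset.range N, P {ω | ENNReal.ofReal η ≤ oscAfter (X n ω) (i * δ) δ} :=
        measure_biUnion_finset_le _ _
    _ ≤ ∑ _i ∈ Finset.range N, ENNReal.ofReal (Real.exp (n * -(C + 1))) := Finset.sum_le_sum hi
    _ = (N : ℝ≥0∞) * ENNReal.ofReal (Real.exp (n * -(C + 1))) := by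
        rw [Finset.sum_const, Finset.card_range, nsmul_eq_mul]
    _ ≤ _ := hn2

end Probability

/-! ### Discontinuous paths -/

lemma localPath_timeScaleInv {k : ℕ} {t : ℝ≥0} (ht : t ≤ k) (x : SkorokhodSpace) :
    localPath k x (timeScaleInv t) = x t := by
  rw [localPath_eq_mul, cutoffWeight_eq_one (strictMono_timeScaleInv.monotone ht), mul_one,
    timeScale_timeScaleInv]

/-- By right continuity, continuity can only fail from the left, where a limit exists. -/
lemma exists_left_jump {φ : SkorokhodSpace} (hφ : φ ∉ continuousPaths) :
    ∃ (t : ℝ≥0) (l : ℝ), (𝓝[<] t).NeBot ∧ Tendsto φ (𝓝[<] t) (𝓝 l) ∧ l ≠ φ t := by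
  have h : ¬ Continuous (φ : ℝ≥0 → ℝ) := hφ
  rw [continuous_iff_continuousAt] at h
  push Not at h
  obtain ⟨t, ht⟩ := h
  obtain ⟨l, hl⟩ := φ.left_limits t
  rw [continuousAt_iff_continuous_left'_right'] at ht
  refine ⟨t, l, ?_, hl, ?_⟩
  · by_contra hb
    rw [not_neBot] at hb
    refine ht ⟨?_, φ.right_continuous t⟩
    rw [ContinuousWithinAt, hb]
    exact tendsto_bot
  · rintro rfl
    exact ht ⟨hl, φ.right_continuous t⟩

/-- Near a discontinuous path the modulus of continuity is bounded below. -/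
lemma exists_ball_disjoint_modulusLE {φ : SkorokhodSpace} (hφ : φ ∉ continuousPaths) :
    ∃ L : ℝ≥0, 0 < L ∧ ∃ η : ℝ, 0 < η ∧ ∀ δ : ℝ≥0, 0 < δ →
      ∃ r > 0, ∀ x ∈ Metric.ball φ r, x ∉ modulusLE L δ (3 * η) := by
  obtain ⟨t₀, l, hne, hl, hlφ⟩ := exists_left_jump hφ
  obtain ⟨k, hk⟩ := exists_nat_gt t₀
  have hη : 0 < |φ t₀ - l| / 12 := by
    have := abs_pos.2 (sub_ne_zero.2 hlφ.symm)
    positivity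
  -- A jump of size `12η` would be at most `3η + η + 2ε < 6η` if a nearby path had modulus `3η`.
  -- Here `L` and `η` depend on `φ` alone, so `δ` may be chosen after them.
  refine ⟨(k + 1 : ℕ), by positivity, |φ t₀ - l| / 12, hη, fun δ hδ => ?_⟩
  set η := |φ t₀ - l| / 12 with hηdef
  have hjump : |φ t₀ - l| = 12 * η := by rw [hηdef]; ring
  have hu₀ : timeScaleInv t₀ ≠ 1 := (timeScaleInv_lt_one t₀).ne
  have hnear : ∀ᶠ u in 𝓝 (timeScaleInv t₀),
      dist (timeScale u) t₀ < δ / 2 ∧ u < timeScaleInv ((k + 1 : ℕ)) := by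
    have h1 := continuousAt_timeScale hu₀
    rw [ContinuousAt, timeScale_timeScaleInv] at h1
    exact (Metric.tendsto_nhds.1 h1 (δ / 2) (by positivity)).and
      (gt_mem_nhds (strictMono_timeScaleInv (hk.trans (by exact_mod_cast Nat.lt_succ_self k))))
  obtain ⟨r₀, hr₀, hr⟩ := Metric.eventually_nhds_iff.1 hnear
  have hβ := Metric.tendsto_nhds.1 ((continuous_timeScaleInv.tendsto t₀).mono_left
    (nhdsWithin_le_nhds (s := Iio t₀))) (r₀ / 2) (by positivity)
  obtain ⟨t₁, ⟨ht₁l, ht₁β⟩, ht₁⟩ := (((Metric.tendsto_nhds.1 hl η hη).and hβ).and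
    self_mem_nhdsWithin).exists
  have ht₁' : t₁ < t₀ := ht₁
  obtain ⟨ε, hε, hεη, hεr⟩ := exists_exp_sub_one_lt hη (half_pos hr₀)
  obtain ⟨r, hr0, hrk⟩ := exists_localDist_lt k hε
  refine ⟨r, hr0, fun x hx hmod => ?_⟩
  obtain ⟨μ, hμ, hμs⟩ := exists_of_prokhorovDist_lt
    (localDist_lt_iff.1 (hrk φ x (by rw [dist_comm]; exact hx)))
  have hshift := fun u => (abs_timeChange_sub_le hε.le hμs u).trans_lt hεr
  have htk : t₀ ≤ (k + 1 : ℕ) := hk.le.trans (by exact_mod_cast Nat.le_succ k)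
  have key : ∀ t ≤ t₀, dist (timeScaleInv t) (timeScaleInv t₀) < r₀ / 2 →
      ∃ s, timeScaleInv s = μ (timeScaleInv t) ∧ dist s t₀ < δ / 2 ∧ s ≤ (k + 1 : ℕ) ∧
        |φ t - x s| ≤ ε := by
    intro t ht hd
    have hv1 : μ (timeScaleInv t) ≠ 1 := by
      intro h
      rw [← show μ 1 = 1 from μ.map_top] at h
      exact (timeScaleInv_lt_one t).ne (μ.injective h)
    have hdist : dist (μ (timeScaleInv t)) (timeScaleInv t₀) < r₀ := by
      refine (dist_triangle _ (timeScaleInv t) _).trans_lt ?_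
      have : dist (μ (timeScaleInv t)) (timeScaleInv t) < r₀ / 2 := hshift _
      linarith
    obtain ⟨h1, h2⟩ := hr hdist
    have h3 := (timeScale_le_iff hv1).2 h2.le
    refine ⟨timeScale (μ (timeScaleInv t)), timeScaleInv_timeScale hv1, h1, h3, ?_⟩
    have h4 := hμ (timeScaleInv t)
    rwa [localPath_timeScaleInv (ht.trans htk), ← timeScaleInv_timeScale hv1,
      localPath_timeScaleInv h3] at h4
  obtain ⟨s₀, hs₀, hs₀d, hs₀k, hs₀φ⟩ := key t₀ le_rfl (by simpa using hr₀)
  obtain ⟨s₁, hs₁, hs₁d, -, hs₁φ⟩ := key t₁ ht₁'.le ht₁β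
  have hs : s₁ < s₀ := by
    rw [← strictMono_timeScaleInv.lt_iff_lt, hs₀, hs₁]
    exact μ.strictMono (strictMono_timeScaleInv ht₁')
  have hsδ : s₀ ≤ s₁ + δ := by
    rw [← NNReal.coe_le_coe, NNReal.coe_add]
    rw [NNReal.dist_eq] at hs₀d hs₁d
    have e1 := abs_lt.1 hs₀d
    have e2 := abs_lt.1 hs₁d
    linarith
  have h1 := hmod s₁ s₀ hs.le hs₀k hsδ
  rw [Real.dist_eq] at ht₁l
  have h2 : |φ t₀ - l| ≤ |φ t₀ - x s₀| + |x s₁ - x s₀| + |φ t₁ - x s₁| + |φ t₁ - l| := by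
    have e : φ t₀ - l = (φ t₀ - x s₀) - (x s₁ - x s₀) - (φ t₁ - x s₁) + (φ t₁ - l) := by ring
    rw [e]
    refine (abs_add_le _ _).trans (add_le_add_left ?_ _)
    refine (abs_sub _ _).trans (add_le_add_left ?_ _)
    exact abs_sub _ _
  linarith

/-! ### Exponential tightness and `C`-exponential tightness -/

section Main

variable {Ω : Type*} [mΩ : MeasurableSpace Ω] {P : Measure Ω} {𝔽 : ℕ → Filtration ℝ≥0 mΩ}
  {X : ℕ → Ω → SkorokhodSpace}

lemma isExponentiallyTight_of_oscAfter [IsFiniteMeasure P]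
    (hX : ∀ n, 1 ≤ n → Adapted (𝔽 n) (fun (t : ℝ≥0) (ω : Ω) => X n ω t))
    (h_sup : ∀ L : ℝ≥0, 0 < L →
      Tendsto
        (fun c : ℝ => limsup
          (fun n : ℕ => logProb P n
            {ω | ENNReal.ofReal c ≤ runningSup (X n ω) L}) atTop)
        atTop (𝓝 ⊥))
    (h_osc : ∀ L : ℝ≥0, 0 < L → ∀ η : ℝ, 0 < η →
      Tendsto
        (fun δ : ℝ≥0 => limsup
          (fun n : ℕ => ⨆ τ ∈ boundedStoppingTimes (𝔽 n) L,
            logProb P n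
              {ω | ENNReal.ofReal η ≤ oscAfter (X n ω) (τ ω) δ}) atTop)
        (𝓝[>] 0) (𝓝 ⊥)) :
    IsExponentiallyTight P X := by
  refine isExponentiallyTight_of_finite_cover fun C ε hε => ?_
  obtain ⟨L, hL, η, hη, hcover⟩ := exists_finite_cover_modulusLE hε
  obtain ⟨c, hc⟩ := ((h_sup L hL).eventually
    (gt_mem_nhds (EReal.bot_lt_coe (-(C + 1))))).exists
  obtain ⟨δ, hδ, hmod⟩ := exists_eventually_measure_modulusLE_compl_le (h_osc L hL η hη) (C + 1)
  obtain ⟨t₀, ht₀, hsub⟩ := hcover c δ hδ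
  obtain ⟨n₀, hn₀⟩ := eventually_atTop.1
    ((eventually_measure_le_of_limsup_lt hc).and (hmod.and (eventually_nat_mul_exp_le 2 C)))
  have hsingle : ∀ n, ∃ t : Set SkorokhodSpace, t.Finite ∧ (1 ≤ n →
      P {ω | X n ω ∉ ⋃ y ∈ t, Metric.ball y ε} ≤ ENNReal.ofReal (Real.exp (n * -C))) := by
    intro n
    by_cases hn : 1 ≤ n
    · obtain ⟨t, ht, hP⟩ := exists_finite_cover_measure_le P (V := X n)
        (fun s => (hX n hn s).mono ((𝔽 n).le s) le_rfl) hε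
        (ENNReal.ofReal_pos.2 (Real.exp_pos (n * -C)))
      exact ⟨t, ht, fun _ => hP⟩
    · exact ⟨∅, finite_empty, fun h => absurd h hn⟩
  choose t ht hP using hsingle
  refine ⟨t₀ ∪ ⋃ n ∈ Finset.range n₀, t n,
    ht₀.union ((Finset.finite_toSet _).biUnion fun n _ => ht n), fun n hn => ?_⟩
  rcases lt_or_ge n n₀ with hlt | hge
  · refine (measure_mono fun ω hω => ?_).trans (hP n hn)
    refine fun hmem => hω (biUnion_subset_biUnion_left ?_ hmem)
    exact fun y hy => Or.inr (mem_iUnion₂.2 ⟨n, Finset.mem_range.2 hlt, hy⟩)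
  · obtain ⟨h1, h2, h3⟩ := hn₀ n hge
    calc P {ω | X n ω ∉ ⋃ y ∈ t₀ ∪ ⋃ n ∈ Finset.range n₀, t n, Metric.ball y ε}
        ≤ P ({ω | ENNReal.ofReal c ≤ runningSup (X n ω) L} ∪
            {ω | X n ω ∉ modulusLE L δ (3 * η)}) := by
          refine measure_mono fun ω hω => ?_
          by_contra hcon
          rw [mem_union, not_or] at hcon
          refine hω (biUnion_subset_biUnion_left subset_union_left (hsub ⟨?_, fun s hs => ?_⟩))
          · exact not_not.1 hcon.2
          · exact abs_le_of_runningSup_lt (not_le.1 hcon.1) hs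
      _ ≤ ENNReal.ofReal (Real.exp (n * -(C + 1))) + ENNReal.ofReal (Real.exp (n * -(C + 1))) :=
          (measure_union_le _ _).trans (add_le_add h1 h2)
      _ = ((2 : ℕ) : ℝ≥0∞) * ENNReal.ofReal (Real.exp (n * -(C + 1))) := by
          rw [Nat.cast_two, two_mul]
      _ ≤ _ := h3

lemma rate_eq_top_of_oscAfter
    (h_osc : ∀ L : ℝ≥0, 0 < L → ∀ η : ℝ, 0 < η →
      Tendsto
        (fun δ : ℝ≥0 => limsup
          (fun n : ℕ => ⨆ τ ∈ boundedStoppingTimes (𝔽 n) L,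
            logProb P n
              {ω | ENNReal.ofReal η ≤ oscAfter (X n ω) (τ ω) δ}) atTop)
        (𝓝[>] 0) (𝓝 ⊥))
    {m : ℕ → ℕ} {I : SkorokhodSpace → ℝ≥0∞} (hm : StrictMono m) (hI : ObeysLDP P X m I)
    {φ : SkorokhodSpace} (hφ : φ ∉ continuousPaths) : I φ = ∞ := by
  by_contra hfin
  obtain ⟨L, hL, η, hη, hball⟩ := exists_ball_disjoint_modulusLE hφ
  -- The level `I φ + 1` strictly beats the rate allowed by the lower bound on any ball around `φ`.
  obtain ⟨δ, hδ, hmod⟩ := exists_eventually_measure_modulusLE_compl_le (h_osc L hL η hη)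
    ((I φ).toReal + 1)
  obtain ⟨r, hr, hdisj⟩ := hball δ hδ
  have hlow := hI.lower_bound (Metric.ball φ r) Metric.isOpen_ball
  have hinf : ((⨅ ψ ∈ Metric.ball φ r, I ψ : ℝ≥0∞) : EReal) ≤ ((I φ).toReal : EReal) := by
    rw [EReal.coe_ennreal_toReal hfin]
    exact EReal.coe_ennreal_le_coe_ennreal_iff.2 (iInf₂_le φ (Metric.mem_ball_self hr))
  have hup : liminf (fun j : ℕ => logProb P (m j) {ω | X (m j) ω ∈ Metric.ball φ r}) atTop ≤
      ((-((I φ).toReal + 1) : ℝ) : EReal) := by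
    refine (liminf_le_limsup).trans (limsup_le_of_le (h := ?_))
    filter_upwards [hm.tendsto_atTop.eventually hmod,
      hm.tendsto_atTop.eventually (eventually_ge_atTop 1)] with j h1 h2
    rw [logProb_le_iff h2]
    have hsub : {ω | X (m j) ω ∈ Metric.ball φ r} ⊆ {ω | X (m j) ω ∉ modulusLE L δ (3 * η)} :=
      fun ω hω => hdisj _ hω
    exact (measure_mono hsub).trans h1
  have h := (EReal.neg_le_neg_iff.2 hinf).trans (hlow.trans hup)
  rw [← EReal.coe_neg, EReal.coe_le_coe_iff] at h
  linarith

end Main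

end ExpTight

theorem theorem3p1 {Ω : Type*} [mΩ : MeasurableSpace Ω] (P : Measure Ω) [IsProbabilityMeasure P]
    (𝔽 : ℕ → Filtration ℝ≥0 mΩ) (X : ℕ → Ω → ExpTight.SkorokhodSpace)
    (hX : ∀ n, 1 ≤ n → Adapted (𝔽 n) (fun (t : ℝ≥0) (ω : Ω) => X n ω t))
    (h_sup : ∀ L : ℝ≥0, 0 < L →
      Tendsto
        (fun c : ℝ => limsup
          (fun n : ℕ => ExpTight.logProb P n
            {ω | ENNReal.ofReal c ≤ ExpTight.runningSup (X n ω) L}) atTop)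
        atTop (𝓝 ⊥))
    (h_osc : ∀ L : ℝ≥0, 0 < L → ∀ η : ℝ, 0 < η →
      Tendsto
        (fun δ : ℝ≥0 => limsup
          (fun n : ℕ => ⨆ τ ∈ ExpTight.boundedStoppingTimes (𝔽 n) L,
            ExpTight.logProb P n
              {ω | ENNReal.ofReal η ≤ ExpTight.oscAfter (X n ω) (τ ω) δ}) atTop)
        (𝓝[>] 0) (𝓝 ⊥)) :
    ExpTight.IsCExponentiallyTight P X := by
  exact ⟨ExpTight.isExponentiallyTight_of_oscAfter hX h_sup h_osc,
    fun _ _ hm hI _ hφ => ExpTight.rate_eq_top_of_oscAfter h_osc hm hI hφ⟩
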